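/- A convex $3$-polytope is a bounded set $P\subset\mathbb R^3$ with nonempty interior given by an irredundant finite system of inequalities $\boldsymbol a_i\boldsymbol x+b_i\geqslant 0$, $i=1,\dots,m$; its facets are $F_i=P\cap\{\boldsymbol a_i\boldsymbol x+b_i=0\}$, its faces are the intersections of facets, and its vertices and edges are its faces of dimension $0$ and $1$. It is simple if every vertex lies in exactly $3$ facets. Let $p_k$ be the number of facets of $P$ with exactly $k$ edges. A $3$-belt of a simple $3$-polytope is a triple of facets $(F_{i},F_{j},F_{k})$ such that $F_{i}\cap F_{j}$, $F_{j}\cap F_{k}$, $F_{k}\cap F_{i}$ are edges and $F_{i}\cap F_{j}\cap F_{k}=\varnothing$. A simple polytope is flag if any nonempty set of pairwise intersecting facets has a nonempty common intersection. A fullerene is a simple $3$-polytope all of whose facets are pentagons and hexagons. Theorem. Let $P$ be a simple convex $3$-polytope with $p_3=0$, $p_4\leqslant 2$, $p_7\leqslant 1$, and $p_k=0$ for all $k\geqslant 8$. Then $P$ has no $3$-belts, and $P$ is a flag polytope. In particular, every fullerene is a flag polytope. -/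

import Mathlib

/-- The polyhedron `{x ∈ ℝⁿ : aᵢ x + bᵢ ≥ 0 for all i ∈ I}` cut out by the half-spaces with indices
in `I`. -/
def polyhedron {n m : ℕ} (a : Fin m → EuclideanSpace ℝ (Fin n)) (b : Fin m → ℝ)
    (I : Set (Fin m)) : Set (EuclideanSpace ℝ (Fin n)) :=
  {x | ∀ i ∈ I, 0 ≤ inner ℝ (a i) x + b i}

/-- A convex `n`-polytope in `ℝⁿ`: a bounded intersection of finitely many closed half-spaces, of
full dimension `n` (it has interior points), given by an irredundant system of inequalities. -/
structure ConvexPolytope (n : ℕ) where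
  /-- The number of inequalities, that is, of facets. -/
  m : ℕ
  a : Fin m → EuclideanSpace ℝ (Fin n)
  b : Fin m → ℝ
  bounded : Bornology.IsBounded (polyhedron a b Set.univ)
  full_dim : (interior (polyhedron a b Set.univ)).Nonempty
  /-- Deleting any one inequality changes the set. -/
  irredundant : ∀ i, polyhedron a b {i}ᶜ ≠ polyhedron a b Set.univ

namespace ConvexPolytope

variable {n : ℕ} (P : ConvexPolytope n)

/-- The polytope as a set of points. -/
def carrier : Set (EuclideanSpace ℝ (Fin n)) := polyhedron P.a P.b Set.univ

/-- The facet `Fᵢ`: the part of the polytope in the hyperplane `aᵢ x + bᵢ = 0`. -/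
def facet (i : Fin P.m) : Set (EuclideanSpace ℝ (Fin n)) :=
  {x ∈ P.carrier | inner ℝ (P.a i) x + P.b i = 0}

/-- A face: an intersection of facets (the polytope itself is the intersection of no facets). -/
def IsFace (F : Set (EuclideanSpace ℝ (Fin n))) : Prop :=
  ∃ S : Set (Fin P.m), F = P.carrier ∩ ⋂ i ∈ S, P.facet i

/-- A vertex: a point that is a face. -/
def IsVertex (v : EuclideanSpace ℝ (Fin n)) : Prop := P.IsFace {v}

/-- An edge: a face of dimension one. -/
def IsEdge (E : Set (EuclideanSpace ℝ (Fin n))) : Prop :=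
  P.IsFace E ∧ Module.finrank ℝ (vectorSpan ℝ E) = 1

/-- An `n`-polytope is simple if every vertex lies in exactly `n` facets. -/
def IsSimple : Prop := ∀ v, P.IsVertex v → {i | v ∈ P.facet i}.ncard = n

/-- A simple polytope is flag if any (nonempty) set of pairwise intersecting facets has a nonempty
intersection. -/
def IsFlag : Prop :=
  P.IsSimple ∧ ∀ S : Set (Fin P.m), S.Nonempty →
    (∀ i ∈ S, ∀ j ∈ S, (P.facet i ∩ P.facet j).Nonempty) → (⋂ i ∈ S, P.facet i).Nonempty

end ConvexPolytope

namespace ConvexPolytope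

variable (P : ConvexPolytope 3)

/-- The number of edges of the facet `Fᵢ` of a `3`-polytope; `Fᵢ` is a `k`-gon when it is `k`. -/
noncomputable def numEdges (i : Fin P.m) : ℕ := {E | P.IsEdge E ∧ E ⊆ P.facet i}.ncard

/-- `p_k`, the number of `k`-gonal facets. -/
noncomputable def p (k : ℕ) : ℕ := {i | P.numEdges i = k}.ncard

/-- A `k`-loop: a cyclic sequence of `k` facets whose successive members (`finRotate k` is the
cyclic successor `j ↦ j + 1 mod k`) intersect in edges. -/
def IsLoop {k : ℕ} (c : Fin k → Fin P.m) : Prop :=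
  ∀ j, P.IsEdge (P.facet (c j) ∩ P.facet (c (finRotate k j)))

/-- A `k`-belt: a `k`-loop with empty total intersection in which two members at different positions
intersect if and only if these positions are cyclically adjacent. -/
def IsBelt {k : ℕ} (c : Fin k → Fin P.m) : Prop :=
  P.IsLoop c ∧ (⋂ j, P.facet (c j)) = ∅ ∧
    ∀ p q : Fin k, p ≠ q →
      ((P.facet (c p) ∩ P.facet (c q)).Nonempty ↔ q = finRotate k p ∨ p = finRotate k q)

/-- A (combinatorial) fullerene: a simple `3`-polytope all of whose facets are pentagons and
hexagons. -/
def IsFullerene : Prop := P.IsSimple ∧ ∀ i, P.numEdges i = 5 ∨ P.numEdges i = 6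

end ConvexPolytope

/-!
Suppose that three facets share edges pairwise but have no common vertex. A plane through interior
points of these three edges meets the polytope in a triangle, so it cuts no other facet. Let
`k₁, k₂, k₃` be the numbers of vertices of the three facets above the plane. Euler's relation for
the part of the polytope above the plane gives `∑ (6 - #edges) = k₁ + k₂ + k₃ - 3`, summed over the
facets that lie entirely above.

This sum of curvatures, counting only its positive terms, exceeds `6`. It is clear if
`k₁ + k₂ + k₃ ≥ 10`. Otherwise some `kᵢ` is `2`, or all are `3`, and replacing one or all of the
three facets by the facets behind them gives another such triple, with fewer facets above its plane.
This descent uses that there are no triangles and that no three quadrilaterals share a vertex.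

The same holds below the plane. But all facets, except perhaps one heptagon, have at most `6` edges,
so the vertex counts of the three facets and the heptagon give at most `18 - 6 + 1 = 13` for the two
sums together.
-/

open Finset in
lemma sum_card_filter_eq_card_of_existsUnique {α β : Type*} {s : Finset α} {t : Finset β}
    {r : α → β → Prop} [∀ a, DecidablePred (r a)] (h : ∀ b ∈ t, ∃! a, a ∈ s ∧ r a b) :
    ∑ a ∈ s, #{b ∈ t | r a b} = #t := by
  calc ∑ a ∈ s, #{b ∈ t | r a b} = ∑ b ∈ t, #{a ∈ s | r a b} :=
        sum_card_bipartiteAbove_eq_sum_card_bipartiteBelow r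
    _ = ∑ b ∈ t, 1 := sum_congr rfl fun b hb => by
        obtain ⟨a, ha, huniq⟩ := h b hb
        exact card_eq_one.2 ⟨a, eq_singleton_iff_unique_mem.2
          ⟨mem_filter.2 ha, fun x hx => huniq x (mem_filter.1 hx)⟩⟩
    _ = #t := (card_eq_sum_ones t).symm

lemma injective_insert_pair_perm {ι α : Type*} [DecidableEq α] {σ : Equiv.Perm ι}
    (hσ : ∀ j, σ (σ j) ≠ j) {c : ι → α} (hc : Function.Injective c) {a : α} (ha : ∀ j, a ≠ c j) :
    Function.Injective fun j => ({a, c j, c (σ j)} : Finset α) := fun j k hjk => by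
  simp only at hjk
  have hj : c j ∈ ({a, c k, c (σ k)} : Finset α) := hjk ▸ by simp
  have hj' : c (σ j) ∈ ({a, c k, c (σ k)} : Finset α) := hjk ▸ by simp
  simp only [Finset.mem_insert, Finset.mem_singleton, (ha _).symm, hc.eq_iff, false_or] at hj hj'
  rcases hj with rfl | rfl
  · rfl
  · exact hj'.elim (fun h => (hσ k h).elim) (σ.injective ·)

lemma fin_three_ne_add_one : ∀ j : Fin 3, j ≠ j + 1 := by decide

lemma fin_three_eq_or_eq_add : ∀ j k : Fin 3, k = j ∨ k = j + 1 ∨ k = j + 1 + 1 := by decide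

lemma injective_of_forall_ne_add_one {α : Type*} {f : Fin 3 → α} (h : ∀ j, f j ≠ f (j + 1)) :
    Function.Injective f := fun j k hjk => by
  rcases (by decide : ∀ j k : Fin 3, j = k ∨ k = j + 1 ∨ j = k + 1) j k with rfl | rfl | rfl
  exacts [rfl, (h _ hjk).elim, (h _ hjk.symm).elim]

section InnerProductSpace

variable {E : Type*} [NormedAddCommGroup E] [InnerProductSpace ℝ E] {K : Set E} {b : ℝ} {u x y : E}

lemma exists_inner_eq_iff_mem_affineSubspace [FiniteDimensional ℝ E] {s : AffineSubspace ℝ E}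
    (hs : (s : Set E).Nonempty)
    (hdim : Module.finrank ℝ s.direction + 1 = Module.finrank ℝ E) :
    ∃ (u : E) (b : ℝ), ∀ x, inner ℝ u x = b ↔ x ∈ s := by
  obtain ⟨p, hp⟩ := hs
  have horth : Module.finrank ℝ s.directionᗮ = 1 := by
    have := s.direction.finrank_add_finrank_orthogonal
    omega
  obtain ⟨⟨u, hus⟩, -, hu⟩ := finrank_eq_one_iff'.1 horth
  have hspan : s.directionᗮ = ℝ ∙ u := by
    refine le_antisymm (fun x hx => ?_) (by simpa using hus)
    obtain ⟨r, hr⟩ := hu ⟨x, hx⟩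
    exact Submodule.mem_span_singleton.2 ⟨r, congrArg Subtype.val hr⟩
  refine ⟨u, inner ℝ u p, fun x => ?_⟩
  rw [← AffineSubspace.vsub_right_mem_direction_iff_mem hp, ← sub_eq_zero, ← inner_sub_right,
    ← Submodule.mem_orthogonal_singleton_iff_inner_right, ← hspan,
    Submodule.orthogonal_orthogonal, vsub_eq_sub]

lemma convex_setOf_lt_inner (u : E) (b : ℝ) : Convex ℝ {x | b < inner ℝ u x} :=
  convex_halfSpace_gt (innerₛₗ ℝ u).isLinear b

lemma lt_inner_of_mem_convexHull (h : ∀ y ∈ K, b < inner ℝ u y) (hx : x ∈ convexHull ℝ K) :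
    b < inner ℝ u x :=
  convexHull_min h (convex_setOf_lt_inner u b) hx

lemma lt_inner_of_convex_of_forall_inner_ne (hK : Convex ℝ K) (hne : ∀ x ∈ K, inner ℝ u x ≠ b)
    (hx : x ∈ K) (hy : y ∈ K) (hbx : b < inner ℝ u x) : b < inner ℝ u y := by
  refine lt_of_le_of_ne (not_lt.1 fun hyb => ?_) (hne y hy).symm
  obtain ⟨z, hz, hzb⟩ := hK.isPreconnected.intermediate_value hy hx
    (f := inner ℝ u) (by fun_prop) ⟨hyb.le, hbx.le⟩
  exact hne z hz hzb

end InnerProductSpace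

namespace ConvexPolytope

open Finset Filter Topology

section Polytope

variable {n : ℕ} {P : ConvexPolytope n} {d u v w x : EuclideanSpace ℝ (Fin n)}
  {i j : Fin P.m} {S T : Finset (Fin P.m)}

variable (P) in
/-- The value at `x` of the affine function defining the `i`-th inequality. -/
noncomputable def slack (i : Fin P.m) (x : EuclideanSpace ℝ (Fin n)) : ℝ :=
  inner ℝ (P.a i) x + P.b i

variable (P) in
/-- The indices of the inequalities that are equalities at `x`; for a point `x` of the polytope,
these are the facets through `x`. -/
noncomputable def active (x : EuclideanSpace ℝ (Fin n)) : Finset (Fin P.m) :=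
  {i | P.slack i x = 0}

variable (P) in
/-- The face in which the inequalities with index in `S` are equalities. -/
def face (S : Finset (Fin P.m)) : Set (EuclideanSpace ℝ (Fin n)) :=
  {x | x ∈ P.carrier ∧ S ⊆ P.active x}

lemma mem_active : i ∈ P.active x ↔ P.slack i x = 0 := by simp [active]

lemma mem_carrier : x ∈ P.carrier ↔ ∀ i, 0 ≤ P.slack i x := by
  simp [carrier, polyhedron, slack]

lemma mem_face : x ∈ P.face S ↔ x ∈ P.carrier ∧ S ⊆ P.active x := Iff.rfl

lemma mem_facet : x ∈ P.facet i ↔ x ∈ P.carrier ∧ i ∈ P.active x := by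
  simp [facet, mem_active, slack]

lemma slack_add_smul (i : Fin P.m) (x d : EuclideanSpace ℝ (Fin n)) (t : ℝ) :
    P.slack i (x + t • d) = P.slack i x + t * inner ℝ (P.a i) d := by
  simp only [slack, inner_add_right, inner_smul_right]; ring

lemma inner_sub_eq_slack_sub (i : Fin P.m) (x y : EuclideanSpace ℝ (Fin n)) :
    inner ℝ (P.a i) (x - y) = P.slack i x - P.slack i y := by
  simp only [slack, inner_sub_right]; ring

lemma slack_pos_of_notMem_active (hx : x ∈ P.carrier) (hi : i ∉ P.active x) : 0 < P.slack i x :=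
  (mem_carrier.1 hx i).lt_of_ne' fun h => hi (mem_active.2 h)

lemma exists_inner_neg (hx : x ∈ P.carrier) (hd : d ≠ 0) : ∃ i, inner ℝ (P.a i) d < 0 := by
  by_contra! h
  obtain ⟨R, hR⟩ := isBounded_iff_forall_norm_le.1 P.bounded
  have hd' : 0 < ‖d‖ := norm_pos_iff.2 hd
  have hR0 : 0 ≤ R := (norm_nonneg x).trans (hR x hx)
  set t := (R + ‖x‖ + 1) / ‖d‖ with ht
  have ht0 : 0 ≤ t := by positivity
  have hmem : x + t • d ∈ P.carrier := mem_carrier.2 fun i => by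
    rw [slack_add_smul]
    exact add_nonneg (mem_carrier.1 hx i) (mul_nonneg ht0 (h i))
  have hnorm : ‖t • d‖ = R + ‖x‖ + 1 := by
    rw [norm_smul, Real.norm_of_nonneg ht0, ht, div_mul_cancel₀ _ hd'.ne']
  have htri : ‖t • d‖ ≤ ‖x + t • d‖ + ‖x‖ := by
    simpa using norm_sub_le (x + t • d) x
  linarith [hR _ hmem]

lemma exists_active_ssubset (hx : x ∈ P.carrier) (hd : d ≠ 0)
    (h : ∀ i ∈ P.active x, inner ℝ (P.a i) d = 0) :
    ∃ t : ℝ, 0 < t ∧ x + t • d ∈ P.carrier ∧ P.active x ⊂ P.active (x + t • d) := by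
  obtain ⟨i₀, hi₀⟩ := exists_inner_neg hx hd
  obtain ⟨j, hj, hmin⟩ := (univ.filter fun i => inner ℝ (P.a i) d < 0).exists_min_image
    (fun i => P.slack i x / -inner ℝ (P.a i) d) ⟨i₀, by simpa using hi₀⟩
  simp only [mem_filter, mem_univ, true_and] at hj hmin
  have hjx : j ∉ P.active x := fun hja => by simp [h j hja] at hj
  set t := P.slack j x / -inner ℝ (P.a j) d with ht
  have ht0 : 0 < t := div_pos (slack_pos_of_notMem_active hx hjx) (by linarith)
  refine ⟨t, ht0, mem_carrier.2 fun i => ?_, (ssubset_iff_of_subset fun i hi => ?_).2 ⟨j, ?_, hjx⟩⟩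
  · rw [slack_add_smul]
    rcases lt_or_ge (inner ℝ (P.a i) d) 0 with hi | hi
    · have := hmin i hi
      rw [le_div_iff₀ (by linarith)] at this
      linarith
    · exact add_nonneg (mem_carrier.1 hx i) (mul_nonneg ht0.le hi)
  · rw [mem_active, slack_add_smul, h i hi, mem_active.1 hi, mul_zero, add_zero]
  · have := hj.ne
    rw [mem_active, slack_add_smul, ht]
    field_simp
    ring

lemma exists_pos_add_smul_mem_carrier (hx : x ∈ P.carrier)
    (hd : ∀ i ∈ P.active x, 0 ≤ inner ℝ (P.a i) d) : ∃ t : ℝ, 0 < t ∧ x + t • d ∈ P.carrier := by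
  have hslack : ∀ i, ∀ᶠ t : ℝ in 𝓝[>] 0, 0 ≤ P.slack i (x + t • d) := fun i => by
    simp only [slack_add_smul]
    by_cases hi : i ∈ P.active x
    · filter_upwards [self_mem_nhdsWithin] with t (ht : 0 < t)
      rw [mem_active.1 hi, zero_add]
      exact mul_nonneg ht.le (hd i hi)
    · have hcont : Tendsto (fun t : ℝ => P.slack i x + t * inner ℝ (P.a i) d) (𝓝[>] 0)
          (𝓝 (P.slack i x + 0 * inner ℝ (P.a i) d)) :=
        (Continuous.tendsto (by fun_prop) 0).mono_left nhdsWithin_le_nhds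
      exact (hcont.eventually_const_lt (by simpa using slack_pos_of_notMem_active hx hi)).mono
        fun t => le_of_lt
  obtain ⟨t, ht, ht0⟩ := ((eventually_all.2 hslack).and self_mem_nhdsWithin).exists
  exact ⟨t, ht0, mem_carrier.2 ht⟩

lemma carrier_inter_iInter_facet (S : Finset (Fin P.m)) :
    P.carrier ∩ ⋂ i ∈ (S : Set (Fin P.m)), P.facet i = P.face S := by
  ext x
  simp only [Set.mem_inter_iff, Set.mem_iInter, mem_facet, mem_face, subset_iff, mem_coe]
  exact and_congr_right fun hx => forall₂_congr fun i _ => and_iff_right hx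

lemma facet_inter_facet (i j : Fin P.m) : P.facet i ∩ P.facet j = P.face {i, j} := by
  ext x
  simp only [Set.mem_inter_iff, mem_facet, mem_face, insert_subset_iff, singleton_subset_iff]
  tauto

lemma isFace_iff {F : Set (EuclideanSpace ℝ (Fin n))} : P.IsFace F ↔ ∃ S, F = P.face S := by
  classical
  refine ⟨fun ⟨T, hT⟩ => ⟨T.toFinset, ?_⟩, fun ⟨S, hS⟩ => ⟨S, ?_⟩⟩
  · rw [hT, ← carrier_inter_iInter_facet, Set.coe_toFinset]
  · rw [hS, ← carrier_inter_iInter_facet]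

lemma convex_carrier : Convex ℝ P.carrier := fun x hx y hy s t hs ht hst =>
  mem_carrier.2 fun i => by
    have hcomb : P.slack i (s • x + t • y) = s * P.slack i x + t * P.slack i y := by
      simp only [slack, inner_add_right, inner_smul_right]
      linear_combination -P.b i * hst
    rw [hcomb]
    exact add_nonneg (mul_nonneg hs (mem_carrier.1 hx i)) (mul_nonneg ht (mem_carrier.1 hy i))

lemma convex_face : Convex ℝ (P.face S) := fun x hx y hy s t hs ht hst =>
  ⟨convex_carrier hx.1 hy.1 hs ht hst, fun i hi => by
    have hx := mem_active.1 (hx.2 hi)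
    have hy := mem_active.1 (hy.2 hi)
    simp only [mem_active, slack, inner_add_right, inner_smul_right] at hx hy ⊢
    linear_combination s * hx + t * hy - P.b i * hst⟩

lemma isVertex_iff : P.IsVertex v ↔
    v ∈ P.carrier ∧ ∀ d, (∀ i ∈ P.active v, inner ℝ (P.a i) d = 0) → d = 0 := by
  refine ⟨fun hv => ?_, fun ⟨hv, h⟩ => ?_⟩
  · obtain ⟨S, hS⟩ := isFace_iff.1 hv
    have hvS : v ∈ P.face S := hS ▸ Set.mem_singleton v
    refine ⟨hvS.1, fun d hd => by_contra fun hd0 => ?_⟩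
    obtain ⟨t, ht, hmem, hsub⟩ := exists_active_ssubset hvS.1 hd0 hd
    have : v + t • d ∈ ({v} : Set _) := hS ▸ ⟨hmem, hvS.2.trans hsub.1⟩
    simp [ht.ne', hd0] at this
  · refine isFace_iff.2 ⟨P.active v, Set.Subset.antisymm ?_ fun x hx => ?_⟩
    · exact Set.singleton_subset_iff.2 ⟨hv, Subset.rfl⟩
    · refine sub_eq_zero.1 (h (x - v) fun i hi => ?_)
      rw [inner_sub_eq_slack_sub, mem_active.1 (hx.2 hi), mem_active.1 hi, sub_zero]

lemma IsVertex.mem_carrier (hv : P.IsVertex v) : v ∈ P.carrier := (isVertex_iff.1 hv).1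

lemma IsVertex.eq_of_active_subset (hv : P.IsVertex v) (h : P.active v ⊆ P.active x) : x = v := by
  refine sub_eq_zero.1 ((isVertex_iff.1 hv).2 (x - v) fun i hi => ?_)
  rw [inner_sub_eq_slack_sub, mem_active.1 hi, mem_active.1 (h hi), sub_zero]

lemma IsVertex.exists_eq_of_inner_le (hv : P.IsVertex v) :
    ∃ u, ∀ x ∈ P.carrier, inner ℝ u v ≤ inner ℝ u x → x = v := by
  set u := -∑ i ∈ P.active v, P.a i with hu
  have hdiff : ∀ x, inner ℝ u (x - v) = -∑ i ∈ P.active v, P.slack i x := fun x => by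
    rw [hu, inner_neg_left, sum_inner]
    exact congrArg _ (sum_congr rfl fun i hi => by
      rw [inner_sub_eq_slack_sub, mem_active.1 hi, sub_zero])
  refine ⟨u, fun x hx hle => hv.eq_of_active_subset fun i hi => mem_active.2 ?_⟩
  rw [← sub_nonneg, ← inner_sub_right, hdiff, neg_nonneg] at hle
  have hslack : ∀ i ∈ P.active v, 0 ≤ P.slack i x := fun i _ => ConvexPolytope.mem_carrier.1 hx i
  exact (sum_eq_zero_iff_of_nonneg hslack).1 (hle.antisymm (sum_nonneg hslack)) i hi

theorem exists_isVertex_inner_le (u : EuclideanSpace ℝ (Fin n)) (hx : x ∈ P.carrier) :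
    ∃ v, P.IsVertex v ∧ P.active x ⊆ P.active v ∧ inner ℝ u x ≤ inner ℝ u v := by
  induction hk : P.m - #(P.active x) using Nat.strong_induction_on generalizing x with
  | _ k ih =>
  by_cases hv : P.IsVertex x
  · exact ⟨x, hv, Subset.rfl, le_rfl⟩
  obtain ⟨d, hd, hd0, hu⟩ :
      ∃ d, (∀ i ∈ P.active x, inner ℝ (P.a i) d = 0) ∧ d ≠ 0 ∧ 0 ≤ inner ℝ u d := by
    rw [isVertex_iff] at hv
    push Not at hv
    obtain ⟨d, hd, hd0⟩ := hv hx
    rcases le_total 0 (inner ℝ u d) with h | h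
    · exact ⟨d, hd, hd0, h⟩
    · exact ⟨-d, by simpa using hd, by simpa using hd0, by simpa using h⟩
  obtain ⟨t, ht, hmem, hsub⟩ := exists_active_ssubset hx hd0 hd
  have hlt : #(P.active x) < #(P.active (x + t • d)) := card_lt_card hsub
  have hle : #(P.active (x + t • d)) ≤ P.m := card_finset_fin_le _
  obtain ⟨v, hv, hsv, huv⟩ := ih _ (by omega) hmem rfl
  refine ⟨v, hv, hsub.1.trans hsv, le_trans ?_ huv⟩
  rw [inner_add_right, inner_smul_right]
  exact le_add_of_nonneg_right (mul_nonneg ht.le hu)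

lemma finite_setOf_isVertex : {v | P.IsVertex v}.Finite :=
  Set.Finite.of_finite_image (f := P.active) (Set.toFinite _) fun _ hv _ _ h =>
    (hv.eq_of_active_subset h.le).symm

variable (P) in
/-- The vertices of the face `P.face S`. -/
noncomputable def verticesOf (S : Finset (Fin P.m)) : Finset (EuclideanSpace ℝ (Fin n)) :=
  {v ∈ P.finite_setOf_isVertex.toFinset | S ⊆ P.active v}

lemma mem_verticesOf : v ∈ P.verticesOf S ↔ P.IsVertex v ∧ S ⊆ P.active v := by
  simp [verticesOf]

lemma mem_verticesOf_singleton : v ∈ P.verticesOf {i} ↔ P.IsVertex v ∧ i ∈ P.active v := by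
  simp [mem_verticesOf]

lemma mem_verticesOf_pair :
    v ∈ P.verticesOf {i, j} ↔ P.IsVertex v ∧ i ∈ P.active v ∧ j ∈ P.active v := by
  simp [mem_verticesOf, insert_subset_iff]

lemma mem_face_of_mem_verticesOf (hv : v ∈ P.verticesOf S) : v ∈ P.face S :=
  ⟨(mem_verticesOf.1 hv).1.mem_carrier, (mem_verticesOf.1 hv).2⟩

lemma verticesOf_nonempty_iff : (P.verticesOf S).Nonempty ↔ (P.face S).Nonempty := by
  refine ⟨fun ⟨v, hv⟩ => ⟨v, mem_face_of_mem_verticesOf hv⟩, fun ⟨x, hx⟩ => ?_⟩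
  obtain ⟨v, hv, hsub, -⟩ := exists_isVertex_inner_le 0 hx.1
  exact ⟨v, mem_verticesOf.2 ⟨hv, hx.2.trans hsub⟩⟩

end Polytope

section Simple

variable {n : ℕ} {P : ConvexPolytope n} {b : ℝ} {u v w x : EuclideanSpace ℝ (Fin n)}
  {i j : Fin P.m} {S T : Finset (Fin P.m)}

lemma IsSimple.card_active (hP : P.IsSimple) (hv : P.IsVertex v) : #(P.active v) = n := by
  rw [← Set.ncard_coe_finset]
  refine (congrArg Set.ncard ?_).trans (hP v hv)
  ext i
  simp [mem_facet, hv.mem_carrier]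

lemma IsSimple.active_eq_of_subset (hP : P.IsSimple) (hv : P.IsVertex v) (hS : S ⊆ P.active v)
    (hcard : #S = n) : P.active v = S :=
  (eq_of_subset_of_card_le hS (by rw [hP.card_active hv, hcard])).symm

lemma IsSimple.card_active_sdiff (hP : P.IsSimple) (hv : v ∈ P.verticesOf S) :
    #(P.active v \ S) = n - #S := by
  rw [mem_verticesOf] at hv
  rw [card_sdiff_of_subset hv.2, hP.card_active hv.1]

lemma IsSimple.exists_forall_inner_eq (hP : P.IsSimple) (hv : P.IsVertex v) (g : Fin P.m → ℝ) :
    ∃ d, ∀ j ∈ P.active v, inner ℝ (P.a j) d = g j := by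
  let L : EuclideanSpace ℝ (Fin n) →ₗ[ℝ] (P.active v → ℝ) :=
    LinearMap.pi fun j => (innerₛₗ ℝ (P.a j) : EuclideanSpace ℝ (Fin n) →ₗ[ℝ] ℝ)
  have hinj : Function.Injective L := (injective_iff_map_eq_zero L).2 fun d hd =>
    (isVertex_iff.1 hv).2 d fun j hj => congrFun hd ⟨j, hj⟩
  have hsurj : Function.Surjective L :=
    (LinearMap.injective_iff_surjective_of_finrank_eq_finrank (by simp [hP.card_active hv])).1 hinj
  obtain ⟨d, hd⟩ := hsurj fun j => g j
  exact ⟨d, fun j hj => congrFun hd ⟨j, hj⟩⟩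

variable (P) in
/-- The direction of the edge along which one leaves the facet `i` at a vertex `v` of a simple
polytope, scaled so that the slack of `i` grows at unit rate. -/
noncomputable def edgeDir (v : EuclideanSpace ℝ (Fin n)) (i : Fin P.m) :
    EuclideanSpace ℝ (Fin n) :=
  Classical.epsilon fun d => ∀ j ∈ P.active v, inner ℝ (P.a j) d = if j = i then 1 else 0

lemma IsSimple.inner_edgeDir (hP : P.IsSimple) (hv : P.IsVertex v) (hj : j ∈ P.active v) :
    inner ℝ (P.a j) (P.edgeDir v i) = if j = i then 1 else 0 :=
  Classical.epsilon_spec (hP.exists_forall_inner_eq hv fun j => if j = i then 1 else 0) j hj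

lemma IsSimple.edgeDir_ne_zero (hP : P.IsSimple) (hv : P.IsVertex v) (hi : i ∈ P.active v) :
    P.edgeDir v i ≠ 0 := fun h => by
  simpa [h] using hP.inner_edgeDir (i := i) hv hi

lemma IsSimple.sub_eq_sum_slack_smul_edgeDir (hP : P.IsSimple) (hv : P.IsVertex v)
    (hx : S ⊆ P.active x) : x - v = ∑ i ∈ P.active v \ S, P.slack i x • P.edgeDir v i := by
  refine sub_eq_zero.1 ((isVertex_iff.1 hv).2 _ fun j hj => ?_)
  rw [inner_sub_right, inner_sum, inner_sub_eq_slack_sub, mem_active.1 hj, sub_zero, sub_eq_zero]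
  simp only [inner_smul_right, hP.inner_edgeDir hv hj, mul_ite, mul_one, mul_zero,
    Finset.sum_ite_eq, Finset.mem_sdiff, hj, true_and]
  split_ifs with hjS
  · exact mem_active.1 (hx hjS)
  · rfl

lemma IsSimple.exists_pos_add_smul_edgeDir_mem_face (hP : P.IsSimple) (hv : P.IsVertex v)
    (i : Fin P.m) : ∃ t : ℝ, 0 < t ∧ v + t • P.edgeDir v i ∈ P.face ((P.active v).erase i) := by
  obtain ⟨t, ht, hmem⟩ := exists_pos_add_smul_mem_carrier (d := P.edgeDir v i) hv.mem_carrier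
    fun j hj => by
      rw [hP.inner_edgeDir hv hj]
      split_ifs <;> norm_num
  refine ⟨t, ht, hmem, fun j hj => ?_⟩
  obtain ⟨hji, hj⟩ := mem_erase.1 hj
  rw [mem_active, slack_add_smul, mem_active.1 hj, hP.inner_edgeDir hv hj, if_neg hji, mul_zero,
    add_zero]

lemma IsSimple.exists_verticesOf_inner_lt (hP : P.IsSimple) (hv : P.IsVertex v)
    (hu : 0 < inner ℝ u (P.edgeDir v i)) :
    ∃ w ∈ P.verticesOf ((P.active v).erase i), inner ℝ u v < inner ℝ u w := by
  obtain ⟨t, ht, hmem⟩ := hP.exists_pos_add_smul_edgeDir_mem_face hv i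
  obtain ⟨w, hw, hsub, hle⟩ := exists_isVertex_inner_le u hmem.1
  refine ⟨w, mem_verticesOf.2 ⟨hw, hmem.2.trans hsub⟩, lt_of_lt_of_le ?_ hle⟩
  rw [inner_add_right, inner_smul_right]
  exact lt_add_of_pos_right _ (mul_pos ht hu)

lemma IsSimple.inner_sub_eq_sum (hP : P.IsSimple) (hv : P.IsVertex v) (hx : S ⊆ P.active x) :
    inner ℝ u x - inner ℝ u v =
      ∑ i ∈ P.active v \ S, P.slack i x * inner ℝ u (P.edgeDir v i) := by
  rw [← inner_sub_right, hP.sub_eq_sum_slack_smul_edgeDir hv hx, inner_sum]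
  exact sum_congr rfl fun i _ => inner_smul_right _ _ _

theorem IsSimple.inner_le_of_inner_edgeDir_nonpos (hP : P.IsSimple) (hv : P.IsVertex v)
    (h : ∀ i ∈ P.active v \ S, inner ℝ u (P.edgeDir v i) ≤ 0) (hx : x ∈ P.face S) :
    inner ℝ u x ≤ inner ℝ u v := by
  rw [← sub_nonpos, hP.inner_sub_eq_sum hv hx.2]
  exact sum_nonpos fun i hi => mul_nonpos_of_nonneg_of_nonpos (mem_carrier.1 hx.1 i) (h i hi)

/-- The graph of a face is connected: a functional exposing a vertex outside `V` would attain its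
maximum over `V` at a vertex from which an edge leads to a larger value. -/
theorem IsSimple.verticesOf_eq_of_closed (hP : P.IsSimple) {V : Finset (EuclideanSpace ℝ (Fin n))}
    (hV : V ⊆ P.verticesOf S) (hne : V.Nonempty)
    (hclosed : ∀ v ∈ V, ∀ i ∈ P.active v \ S, P.verticesOf ((P.active v).erase i) ⊆ V) :
    P.verticesOf S = V := by
  refine subset_antisymm (fun w hw => ?_) hV
  obtain ⟨u, hu⟩ := (mem_verticesOf.1 hw).1.exists_eq_of_inner_le
  obtain ⟨v, hv, hmax⟩ := V.exists_max_image (inner ℝ u) hne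
  have hvS := mem_verticesOf.1 (hV hv)
  have hle : inner ℝ u w ≤ inner ℝ u v := by
    refine hP.inner_le_of_inner_edgeDir_nonpos hvS.1 (fun i hi => not_lt.1 fun hpos => ?_)
      (mem_face_of_mem_verticesOf hw)
    obtain ⟨z, hz, hlt⟩ := hP.exists_verticesOf_inner_lt hvS.1 hpos
    exact (hmax z (hclosed v hv i hi hz)).not_gt hlt
  rwa [← hu v hvS.1.mem_carrier hle]

variable (P) in
/-- The functional `u` decreases along all edges at the vertex `v` of the face `P.face S`, so that
`v` is its unique maximum on that face. -/
def IsPeak (u : EuclideanSpace ℝ (Fin n)) (S : Finset (Fin P.m)) (v : EuclideanSpace ℝ (Fin n)) :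
    Prop :=
  ∀ i ∈ P.active v \ S, inner ℝ u (P.edgeDir v i) < 0

noncomputable instance : DecidablePred (P.IsPeak u S) := fun _ => Finset.decidableDforallFinset

variable (P) in
/-- A functional that is not constant along any edge, as in a Morse-theoretic sweep. -/
def IsGeneric (u : EuclideanSpace ℝ (Fin n)) : Prop :=
  ∀ v, P.IsVertex v → ∀ i ∈ P.active v, inner ℝ u (P.edgeDir v i) ≠ 0

lemma IsGeneric.neg (hu : P.IsGeneric u) : P.IsGeneric (-u) := fun v hv i hi => by
  simpa using hu v hv i hi

lemma IsSimple.inner_le_of_isPeak (hP : P.IsSimple) (hv : P.IsVertex v) (h : P.IsPeak u S v)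
    (hx : x ∈ P.face S) : inner ℝ u x ≤ inner ℝ u v :=
  hP.inner_le_of_inner_edgeDir_nonpos hv (fun i hi => (h i hi).le) hx

lemma IsSimple.eq_of_isPeak (hP : P.IsSimple) (hv : P.IsVertex v) (h : P.IsPeak u S v)
    (hx : x ∈ P.face S) (hle : inner ℝ u v ≤ inner ℝ u x) : x = v := by
  have hterm : ∀ i ∈ P.active v \ S, P.slack i x * inner ℝ u (P.edgeDir v i) ≤ 0 := fun i hi =>
    mul_nonpos_of_nonneg_of_nonpos (mem_carrier.1 hx.1 i) (h i hi).le
  have hsum := hP.inner_sub_eq_sum (u := u) hv hx.2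
  have hzero := (sum_eq_zero_iff_of_nonpos hterm).1
    ((sum_nonpos hterm).antisymm (hsum ▸ sub_nonneg.2 hle))
  rw [← sub_eq_zero, hP.sub_eq_sum_slack_smul_edgeDir hv hx.2]
  refine sum_eq_zero fun i hi => ?_
  rw [(mul_eq_zero.1 (hzero i hi)).resolve_right (h i hi).ne, zero_smul]

theorem IsSimple.existsUnique_isPeak (hP : P.IsSimple) (hu : P.IsGeneric u)
    (hS : (P.verticesOf S).Nonempty) : ∃! v, v ∈ P.verticesOf S ∧ P.IsPeak u S v := by
  obtain ⟨v, hv, hmax⟩ := (P.verticesOf S).exists_max_image (inner ℝ u) hS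
  obtain ⟨hvtx, hSv⟩ := mem_verticesOf.1 hv
  have hpeak : P.IsPeak u S v := fun i hi => by
    obtain ⟨hi, hiS⟩ := Finset.mem_sdiff.1 hi
    refine lt_of_le_of_ne (not_lt.1 fun hpos => ?_) (hu v hvtx i hi)
    obtain ⟨w, hw, hlt⟩ := hP.exists_verticesOf_inner_lt hvtx hpos
    rw [mem_verticesOf] at hw
    have hwS : w ∈ P.verticesOf S :=
      mem_verticesOf.2 ⟨hw.1, (subset_erase.2 ⟨hSv, hiS⟩).trans hw.2⟩
    exact (hmax w hwS).not_gt hlt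
  refine ⟨v, ⟨hv, hpeak⟩, fun w ⟨hw, hwpeak⟩ => ?_⟩
  exact hP.eq_of_isPeak hvtx hpeak (mem_face_of_mem_verticesOf hw)
    (hP.inner_le_of_isPeak (mem_verticesOf.1 hw).1 hwpeak (mem_face_of_mem_verticesOf hv))

lemma IsSimple.exists_isGeneric_mem (hP : P.IsSimple) {U : Set (EuclideanSpace ℝ (Fin n))}
    (hU : U ∈ 𝓝 u) : ∃ z ∈ U, P.IsGeneric z := by
  classical
  let D := (P.verticesOf ∅).biUnion fun v => (P.active v).image (P.edgeDir v)
  have hD : ∀ d, d ∈ D ↔ ∃ v, P.IsVertex v ∧ ∃ i ∈ P.active v, P.edgeDir v i = d := by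
    simp [D, mem_verticesOf]
  have hdense : Dense (⋂ d ∈ (D : Set (EuclideanSpace ℝ (Fin n))), {z | inner ℝ z d ≠ 0}) := by
    refine dense_biInter_of_isOpen (fun d _ => isOpen_ne_fun (by fun_prop) (by fun_prop))
      D.countable_toSet fun d hd => ?_
    obtain ⟨v, hv, i, hi, rfl⟩ := (hD d).1 hd
    have hopen : IsOpenMap (innerSL ℝ (P.edgeDir v i)) :=
      ContinuousLinearMap.isOpenMap_of_ne_zero _ fun h => hP.edgeDir_ne_zero hv hi <| by
        simpa using congrArg (fun f => f (P.edgeDir v i)) h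
    convert (dense_compl_singleton (0 : ℝ)).preimage hopen using 1
    ext z
    simp [real_inner_comm]
  obtain ⟨z, hz, hzU⟩ := hdense.inter_nhds_nonempty hU
  exact ⟨z, hzU, fun v hv i hi => Set.mem_iInter₂.1 hz _ ((hD _).2 ⟨v, hv, i, hi, rfl⟩)⟩

/-- Each end of an edge is a peak of exactly one of `u` and `-u`, and both have exactly one peak. -/
theorem IsSimple.card_verticesOf_eq_two (hP : P.IsSimple) (hS : #S + 1 = n)
    (hne : (P.verticesOf S).Nonempty) : #(P.verticesOf S) = 2 := by
  classical
  obtain ⟨u, -, hu⟩ := hP.exists_isGeneric_mem (u := 0) univ_mem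
  obtain ⟨v, ⟨hv, hvpeak⟩, hvuniq⟩ := hP.existsUnique_isPeak hu hne
  obtain ⟨w, ⟨hw, hwpeak⟩, hwuniq⟩ := hP.existsUnique_isPeak hu.neg hne
  have hone : ∀ z ∈ P.verticesOf S, ∃ i ∈ P.active z, P.active z \ S = {i} := fun z hz => by
    obtain ⟨i, hi⟩ := card_eq_one.1 ((hP.card_active_sdiff hz).trans (by omega))
    exact ⟨i, (Finset.mem_sdiff.1 (hi ▸ mem_singleton_self i)).1, hi⟩
  refine card_eq_two.2 ⟨v, w, ?_, Subset.antisymm (fun z hz => ?_) ?_⟩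
  · rintro rfl
    obtain ⟨i, -, hi⟩ := hone v hv
    have hneg := hvpeak i (by simp [hi])
    have hpos := hwpeak i (by simp [hi])
    rw [inner_neg_left] at hpos
    linarith
  · obtain ⟨i, hiz, hi⟩ := hone z hz
    rw [mem_insert, mem_singleton]
    rcases (hu z (mem_verticesOf.1 hz).1 i hiz).lt_or_gt with hlt | hgt
    · exact .inl (hvuniq z ⟨hz, by simpa [IsPeak, hi] using hlt⟩)
    · exact .inr (hwuniq z ⟨hz, by simpa [IsPeak, hi] using hgt⟩)
  · exact insert_subset hv (singleton_subset_iff.2 hw)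

lemma IsSimple.verticesOf_eq_pair (hP : P.IsSimple) (hS : #S + 1 = n) (hv : v ∈ P.verticesOf S)
    (hw : w ∈ P.verticesOf S) (hne : v ≠ w) : P.verticesOf S = {v, w} :=
  (eq_of_subset_of_card_le (insert_subset hv (singleton_subset_iff.2 hw))
    (by rw [hP.card_verticesOf_eq_two hS ⟨v, hv⟩, card_pair hne])).symm

lemma IsSimple.vectorSpan_face (hP : P.IsSimple) (hv : v ∈ P.verticesOf S) :
    vectorSpan ℝ (P.face S) =
      Submodule.span ℝ (Set.range fun i : ↥(P.active v \ S) => P.edgeDir v i) := by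
  obtain ⟨hvtx, hS⟩ := mem_verticesOf.1 hv
  have hvface := mem_face_of_mem_verticesOf hv
  apply le_antisymm
  · rw [vectorSpan_eq_span_vsub_set_right ℝ hvface, Submodule.span_le]
    rintro _ ⟨x, hx, rfl⟩
    simp only [vsub_eq_sub]
    rw [hP.sub_eq_sum_slack_smul_edgeDir hvtx hx.2]
    exact Submodule.sum_mem _ fun i hi =>
      Submodule.smul_mem _ _ (Submodule.subset_span ⟨⟨i, hi⟩, rfl⟩)
  · rw [Submodule.span_le]
    rintro _ ⟨⟨i, hi⟩, rfl⟩
    obtain ⟨t, ht, hmem⟩ := hP.exists_pos_add_smul_edgeDir_mem_face hvtx i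
    have hface : v + t • P.edgeDir v i ∈ P.face S :=
      ⟨hmem.1, (subset_erase.2 ⟨hS, (Finset.mem_sdiff.1 hi).2⟩).trans hmem.2⟩
    have := Submodule.smul_mem _ t⁻¹ (vsub_mem_vectorSpan ℝ hface hvface)
    simpa [smul_smul, inv_mul_cancel₀ ht.ne'] using this

lemma IsSimple.linearIndependent_edgeDir (hP : P.IsSimple) (hv : P.IsVertex v) :
    LinearIndependent ℝ fun i : P.active v => P.edgeDir v i := by
  refine Fintype.linearIndependent_iff.2 fun g hg j => ?_
  have := congrArg (inner ℝ (P.a j)) hg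
  simpa [inner_sum, inner_smul_right, hP.inner_edgeDir hv j.2, Subtype.coe_inj] using this

theorem IsSimple.finrank_vectorSpan_face (hP : P.IsSimple) (hv : v ∈ P.verticesOf S) :
    Module.finrank ℝ (vectorSpan ℝ (P.face S)) = n - #S := by
  have hli : LinearIndependent ℝ fun i : ↥(P.active v \ S) => P.edgeDir v i :=
    (hP.linearIndependent_edgeDir (mem_verticesOf.1 hv).1).comp (Set.inclusion sdiff_subset)
      (Set.inclusion_injective _)
  rw [hP.vectorSpan_face hv, finrank_span_eq_card hli, Fintype.card_coe, hP.card_active_sdiff hv]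

lemma IsSimple.subset_of_face_subset (hP : P.IsSimple) (hne : (P.verticesOf S).Nonempty)
    (h : P.face S ⊆ P.face T) : T ⊆ S := by
  classical
  obtain ⟨v, hv⟩ := hne
  have hface : P.face (S ∪ T) = P.face S :=
    Set.Subset.antisymm (fun x hx => ⟨hx.1, subset_union_left.trans hx.2⟩)
      fun x hx => ⟨hx.1, union_subset hx.2 (h hx).2⟩
  have hvST : v ∈ P.verticesOf (S ∪ T) :=
    mem_verticesOf.2 ⟨(mem_verticesOf.1 hv).1,
      (hface ▸ mem_face_of_mem_verticesOf hv : v ∈ P.face (S ∪ T)).2⟩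
  have hdim := hP.finrank_vectorSpan_face hvST
  have hle := card_le_card (mem_verticesOf.1 hvST).2
  rw [hface, hP.finrank_vectorSpan_face hv] at hdim
  rw [hP.card_active (mem_verticesOf.1 hv).1] at hle
  exact union_eq_left.1 (eq_of_subset_of_card_le subset_union_left (by omega)).symm

end Simple

section Sweep

variable {n : ℕ} {P : ConvexPolytope n} {b : ℝ} {u v w z : EuclideanSpace ℝ (Fin n)}
  {i : Fin P.m} {S : Finset (Fin P.m)}

variable (P) in
/-- The vertices of the face `P.face S` in the open half-space `b < ⟪u, ·⟫`. -/
noncomputable def upperVertices (u : EuclideanSpace ℝ (Fin n)) (b : ℝ) (S : Finset (Fin P.m)) :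
    Finset (EuclideanSpace ℝ (Fin n)) :=
  {v ∈ P.verticesOf S | b < inner ℝ u v}

variable (P) in
/-- The facets all of whose vertices lie in the open half-space `b < ⟪u, ·⟫`. -/
noncomputable def above (u : EuclideanSpace ℝ (Fin n)) (b : ℝ) : Finset (Fin P.m) :=
  {i | (P.verticesOf {i}).Nonempty ∧ ∀ v ∈ P.verticesOf {i}, b < inner ℝ u v}

lemma mem_upperVertices : v ∈ P.upperVertices u b S ↔ v ∈ P.verticesOf S ∧ b < inner ℝ u v := by
  simp [upperVertices]

lemma mem_upperVertices_singleton :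
    v ∈ P.upperVertices u b {i} ↔ v ∈ P.upperVertices u b ∅ ∧ i ∈ P.active v := by
  simp only [mem_upperVertices, mem_verticesOf, singleton_subset_iff, empty_subset, and_true]
  tauto

lemma IsSimple.sum_card_upperVertices (hP : P.IsSimple) (u : EuclideanSpace ℝ (Fin n)) (b : ℝ) :
    ∑ i, #(P.upperVertices u b {i}) = n * #(P.upperVertices u b ∅) := by
  classical
  have hswap := sum_card_bipartiteAbove_eq_sum_card_bipartiteBelow (s := univ)
    (t := P.upperVertices u b ∅) fun i v => i ∈ P.active v
  have hsingle : ∀ i, bipartiteAbove (fun i v => i ∈ P.active v) (P.upperVertices u b ∅) i =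
      P.upperVertices u b {i} := fun i => ext fun v => by
    rw [mem_bipartiteAbove, mem_upperVertices_singleton]
  simp only [hsingle] at hswap
  rw [hswap, mul_comm, ← smul_eq_mul, ← sum_const]
  refine sum_congr rfl fun v hv => ?_
  rw [bipartiteBelow, filter_mem_eq_inter, univ_inter,
    hP.card_active (mem_verticesOf.1 (mem_upperVertices.1 hv).1).1]

lemma mem_above : i ∈ P.above u b ↔
    (P.verticesOf {i}).Nonempty ∧ ∀ v ∈ P.verticesOf {i}, b < inner ℝ u v := by
  simp [above]

lemma IsSimple.existsUnique_isPeak_upperVertices (hP : P.IsSimple) (hu : P.IsGeneric u)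
    (hne : (P.upperVertices u b S).Nonempty) :
    ∃! v, v ∈ P.upperVertices u b S ∧ P.IsPeak u S v := by
  obtain ⟨w, hw⟩ := hne
  rw [mem_upperVertices] at hw
  obtain ⟨v, ⟨hv, hpeak⟩, huniq⟩ := hP.existsUnique_isPeak hu ⟨w, hw.1⟩
  have hbv : b < inner ℝ u v := hw.2.trans_le
    (hP.inner_le_of_isPeak (mem_verticesOf.1 hv).1 hpeak (mem_face_of_mem_verticesOf hw.1))
  exact ⟨v, ⟨mem_upperVertices.2 ⟨hv, hbv⟩, hpeak⟩,
    fun z hz => huniq z ⟨(mem_upperVertices.1 hz.1).1, hz.2⟩⟩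

lemma IsSimple.existsUnique_isPeak_neg_upperVertices (hP : P.IsSimple) (hu : P.IsGeneric u)
    (hne : (P.verticesOf S).Nonempty) (hall : ∀ v ∈ P.verticesOf S, b < inner ℝ u v) :
    ∃! v, v ∈ P.upperVertices u b S ∧ P.IsPeak (-u) S v := by
  have heq : P.upperVertices u b S = P.verticesOf S := filter_true_of_mem hall
  rw [heq]
  exact hP.existsUnique_isPeak hu.neg hne

lemma IsSimple.lt_inner_of_isPeak_neg (hP : P.IsSimple) (hv : v ∈ P.upperVertices u b S)
    (hpeak : P.IsPeak (-u) S v) (hw : w ∈ P.verticesOf S) : b < inner ℝ u w := by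
  rw [mem_upperVertices] at hv
  have hle := hP.inner_le_of_isPeak (mem_verticesOf.1 hv.1).1 hpeak (mem_face_of_mem_verticesOf hw)
  simp only [inner_neg_left, neg_le_neg_iff] at hle
  exact hv.2.trans_le hle

lemma sum_card_filter_isPeak {F : Finset (Fin P.m)}
    (hF : ∀ i ∈ F, ∃! v, v ∈ P.upperVertices u b {i} ∧ P.IsPeak z {i} v)
    (hmem : ∀ i, ∀ v ∈ P.upperVertices u b {i}, P.IsPeak z {i} v → i ∈ F) :
    ∑ v ∈ P.upperVertices u b ∅, #{i ∈ P.active v | P.IsPeak z {i} v} = #F := by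
  classical
  rw [← sum_card_filter_eq_card_of_existsUnique (s := P.upperVertices u b ∅) (t := F)
    (r := fun v i => i ∈ P.active v ∧ P.IsPeak z {i} v)]
  · refine sum_congr rfl fun v hv => congrArg _ (ext fun i => ?_)
    simp only [mem_filter]
    exact ⟨fun h => ⟨hmem i v (mem_upperVertices_singleton.2 ⟨hv, h.1⟩) h.2, h⟩, fun h => h.2⟩
  · simpa only [mem_upperVertices_singleton, and_assoc] using hF

end Sweep

section Euler

variable {P : ConvexPolytope 3} {b : ℝ} {u v : EuclideanSpace ℝ (Fin 3)}

lemma IsSimple.card_filter_isPeak_add (hP : P.IsSimple) (hu : P.IsGeneric u)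
    (hv : P.IsVertex v) :
    #{i ∈ P.active v | P.IsPeak u {i} v} + #{i ∈ P.active v | P.IsPeak (-u) {i} v} =
      1 + 2 * (if P.IsPeak u ∅ v then 1 else 0) + 2 * (if P.IsPeak (-u) ∅ v then 1 else 0) := by
  obtain ⟨i, j, k, hij, hik, hjk, hact⟩ := card_eq_three.1 (hP.card_active hv)
  have hsingle : ∀ z l, P.IsPeak z {l} v ↔ (i ≠ l → inner ℝ z (P.edgeDir v i) < 0) ∧
      (j ≠ l → inner ℝ z (P.edgeDir v j) < 0) ∧ (k ≠ l → inner ℝ z (P.edgeDir v k) < 0) := by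
    intro z l
    simp only [IsPeak, hact, Finset.mem_sdiff, mem_insert, mem_singleton]
    grind
  have hempty : ∀ z, P.IsPeak z ∅ v ↔ inner ℝ z (P.edgeDir v i) < 0 ∧
      inner ℝ z (P.edgeDir v j) < 0 ∧ inner ℝ z (P.edgeDir v k) < 0 := by
    intro z
    simp [IsPeak, hact]
  simp only [hsingle, hempty, hact, inner_neg_left, neg_lt_zero, filter_insert, filter_singleton]
  rcases (hu v hv i (by simp [hact])).lt_or_gt with hi | hi <;>
    rcases (hu v hv j (by simp [hact])).lt_or_gt with hj | hj <;>
    rcases (hu v hv k (by simp [hact])).lt_or_gt with hk | hk <;>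
    simp [hi, hj, hk, hi.not_gt, hj.not_gt, hk.not_gt, hij, hik, hjk, hij.symm, hik.symm, hjk.symm]

/-- A vertex is the highest or lowest vertex of exactly one of its three facets, unless it is the
highest or lowest vertex of the polytope, when this holds for all three. -/
lemma IsSimple.card_upperVertices_add_two_of_isGeneric (hP : P.IsSimple) (hu : P.IsGeneric u)
    (hpos : (P.upperVertices u b ∅).Nonempty) (hneg : ∃ v, P.IsVertex v ∧ inner ℝ u v ≤ b) :
    #(P.upperVertices u b ∅) + 2 =
      #{i | (P.upperVertices u b {i}).Nonempty} + #(P.above u b) := by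
  have hpeaks : ∑ v ∈ P.upperVertices u b ∅, #{i ∈ P.active v | P.IsPeak u {i} v} =
      #{i | (P.upperVertices u b {i}).Nonempty} :=
    sum_card_filter_isPeak
      (fun i hi => hP.existsUnique_isPeak_upperVertices hu (mem_filter.1 hi).2)
      fun i v hv _ => mem_filter.2 ⟨mem_univ i, v, hv⟩
  have hpits : ∑ v ∈ P.upperVertices u b ∅, #{i ∈ P.active v | P.IsPeak (-u) {i} v} =
      #(P.above u b) :=
    sum_card_filter_isPeak
      (fun i hi =>
        hP.existsUnique_isPeak_neg_upperVertices hu (mem_above.1 hi).1 (mem_above.1 hi).2)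
      fun i v hv hpit => mem_above.2
        ⟨⟨v, (mem_upperVertices.1 hv).1⟩, fun w hw => hP.lt_inner_of_isPeak_neg hv hpit hw⟩
  have hpeak : #{v ∈ P.upperVertices u b ∅ | P.IsPeak u ∅ v} = 1 := by
    obtain ⟨v, hv, huniq⟩ := hP.existsUnique_isPeak_upperVertices hu hpos
    exact card_eq_one.2 ⟨v, eq_singleton_iff_unique_mem.2
      ⟨mem_filter.2 hv, fun z hz => huniq z (mem_filter.1 hz)⟩⟩
  have hpit : #{v ∈ P.upperVertices u b ∅ | P.IsPeak (-u) ∅ v} = 0 := by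
    obtain ⟨w, hw, hwb⟩ := hneg
    refine card_eq_zero.2 (filter_eq_empty_iff.2 fun v hv hpit => hwb.not_gt ?_)
    exact hP.lt_inner_of_isPeak_neg hv hpit (mem_verticesOf.2 ⟨hw, empty_subset _⟩)
  rw [← hpeaks, ← hpits, ← sum_add_distrib, sum_congr rfl fun v hv =>
    hP.card_filter_isPeak_add hu (mem_verticesOf.1 (mem_upperVertices.1 hv).1).1]
  rw [sum_add_distrib, sum_add_distrib, ← mul_sum, ← mul_sum, ← card_filter, ← card_filter,
    hpeak, hpit]
  simp

theorem IsSimple.card_upperVertices_add_two (hP : P.IsSimple)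
    (hb : ∀ v, P.IsVertex v → inner ℝ u v ≠ b)
    (hpos : (P.upperVertices u b ∅).Nonempty) (hneg : ∃ v, P.IsVertex v ∧ inner ℝ u v < b) :
    #(P.upperVertices u b ∅) + 2 =
      #{i | (P.upperVertices u b {i}).Nonempty} + #(P.above u b) := by
  have hnear : {z | ∀ v ∈ P.verticesOf ∅, (b < inner ℝ z v ↔ b < inner ℝ u v)} ∈ 𝓝 u := by
    refine (eventually_all_finset _).2 fun v hv => ?_
    have ht : Tendsto (fun z => inner ℝ z v) (𝓝 u) (𝓝 (inner ℝ u v)) :=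
      Continuous.tendsto (by fun_prop) u
    rcases (hb v (mem_verticesOf.1 hv).1).lt_or_gt with h | h
    · filter_upwards [ht.eventually_lt_const h] with z hz
      exact iff_of_false hz.not_gt h.not_gt
    · filter_upwards [ht.eventually_const_lt h] with z hz
      exact iff_of_true hz h
  obtain ⟨z, hz, hgen⟩ := hP.exists_isGeneric_mem hnear
  have hzu : ∀ S, ∀ v ∈ P.verticesOf S, (b < inner ℝ z v ↔ b < inner ℝ u v) := fun S v hv =>
    hz v (mem_verticesOf.2 ⟨(mem_verticesOf.1 hv).1, empty_subset _⟩)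
  have hupper : P.upperVertices z b = P.upperVertices u b := funext fun S =>
    filter_congr (hzu S)
  have habove : P.above z b = P.above u b := filter_congr fun i _ =>
    and_congr_right fun _ => forall₂_congr (hzu {i})
  obtain ⟨w, hw, hwb⟩ := hneg
  rw [← hupper] at hpos
  rw [← hupper, ← habove]
  refine hP.card_upperVertices_add_two_of_isGeneric hgen hpos ⟨w, hw, not_lt.1 fun h => ?_⟩
  exact hwb.not_gt ((hzu ∅ w (mem_verticesOf.2 ⟨hw, empty_subset _⟩)).1 h)

end Euler

section Polygons

variable {P : ConvexPolytope 3} {v w : EuclideanSpace ℝ (Fin 3)} {i j k : Fin P.m}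

lemma IsSimple.active_eq_triple (hP : P.IsSimple) (hv : v ∈ P.verticesOf {i, j})
    (hk : k ∈ P.active v) (hij : i ≠ j) (hik : i ≠ k) (hjk : j ≠ k) : P.active v = {i, j, k} := by
  rw [mem_verticesOf_pair] at hv
  exact hP.active_eq_of_subset hv.1 (by simp [insert_subset_iff, hv, hk])
    (card_eq_three.2 ⟨i, j, k, hij, hik, hjk, rfl⟩)

lemma IsSimple.exists_active_eq_triple (hP : P.IsSimple) (hij : i ≠ j)
    (hv : v ∈ P.verticesOf {i, j}) : ∃ k, k ≠ i ∧ k ≠ j ∧ P.active v = {i, j, k} := by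
  obtain ⟨k, hk⟩ := card_eq_one.1 ((hP.card_active_sdiff hv).trans (by rw [card_pair hij]))
  have hmem : k ∈ P.active v \ {i, j} := hk ▸ mem_singleton_self k
  simp only [Finset.mem_sdiff, mem_insert, mem_singleton, not_or] at hmem
  exact ⟨k, hmem.2.1, hmem.2.2,
    hP.active_eq_triple hv hmem.1 hij (Ne.symm hmem.2.1) (Ne.symm hmem.2.2)⟩

lemma IsSimple.card_verticesOf_pair (hP : P.IsSimple) (hij : i ≠ j)
    (h : (P.verticesOf {i, j}).Nonempty) : #(P.verticesOf {i, j}) = 2 :=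
  hP.card_verticesOf_eq_two (by rw [card_pair hij]) h

variable (P) in
/-- The facets that share an edge with the facet `i`. -/
noncomputable def neighbors (i : Fin P.m) : Finset (Fin P.m) :=
  {j | j ≠ i ∧ (P.verticesOf {i, j}).Nonempty}

lemma mem_neighbors : j ∈ P.neighbors i ↔ j ≠ i ∧ (P.verticesOf {i, j}).Nonempty := by
  simp [neighbors]

/-- In the cycle of edges of a facet, each edge has two vertices and each vertex lies on two
edges. -/
lemma IsSimple.card_neighbors (hP : P.IsSimple) (i : Fin P.m) :
    #(P.neighbors i) = #(P.verticesOf {i}) := by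
  refine Nat.eq_of_mul_eq_mul_right two_pos
    (card_mul_eq_card_mul (fun j v => j ∈ P.active v) (fun j hj => ?_) fun v hv => ?_)
  · rw [mem_neighbors] at hj
    rw [← hP.card_verticesOf_pair hj.1.symm hj.2]
    congr 1
    ext v
    simp [mem_verticesOf_pair, mem_verticesOf_singleton, and_assoc]
  · rw [mem_verticesOf_singleton] at hv
    have hbelow : bipartiteBelow (fun j v => j ∈ P.active v) (P.neighbors i) v =
        (P.active v).erase i := by
      ext j
      simp only [mem_bipartiteBelow, mem_neighbors, mem_erase]
      exact ⟨fun h => ⟨h.1.1, h.2⟩,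
        fun h => ⟨⟨h.1, v, mem_verticesOf_pair.2 ⟨hv.1, hv.2, h.2⟩⟩, h.2⟩⟩
    simp [hbelow, card_erase_of_mem hv.2, hP.card_active hv.1]

lemma IsSimple.isEdge_face_pair (hP : P.IsSimple) (hij : i ≠ j)
    (h : (P.verticesOf {i, j}).Nonempty) : P.IsEdge (P.face {i, j}) :=
  ⟨isFace_iff.2 ⟨_, rfl⟩, by rw [hP.finrank_vectorSpan_face h.choose_spec, card_pair hij]⟩

lemma IsSimple.exists_eq_face_of_isEdge (hP : P.IsSimple) {E : Set (EuclideanSpace ℝ (Fin 3))}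
    (hE : P.IsEdge E) : ∃ S, E = P.face S ∧ (P.verticesOf S).Nonempty ∧ #S = 2 := by
  obtain ⟨S, rfl⟩ := isFace_iff.1 hE.1
  have hne : (P.verticesOf S).Nonempty := by
    refine verticesOf_nonempty_iff.2 (Set.nonempty_iff_ne_empty.2 fun h => ?_)
    have hdim := hE.2
    rw [h, vectorSpan_empty, finrank_bot] at hdim
    exact zero_ne_one hdim
  have hdim := hE.2
  rw [hP.finrank_vectorSpan_face hne.choose_spec] at hdim
  exact ⟨S, rfl, hne, by omega⟩

lemma IsSimple.setOf_isEdge_subset_facet (hP : P.IsSimple) (i : Fin P.m) :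
    {E | P.IsEdge E ∧ E ⊆ P.facet i} = (fun j => P.face {i, j}) '' (P.neighbors i) := by
  ext E
  simp only [Set.mem_ofPred_eq, Set.mem_image, mem_coe, mem_neighbors]
  refine ⟨fun ⟨hE, hsub⟩ => ?_, ?_⟩
  · obtain ⟨S, rfl, hne, hcard⟩ := hP.exists_eq_face_of_isEdge hE
    have hiS : {i} ⊆ S := hP.subset_of_face_subset hne fun x hx =>
      ⟨hx.1, singleton_subset_iff.2 (mem_facet.1 (hsub hx)).2⟩
    rw [singleton_subset_iff] at hiS
    obtain ⟨j, hj⟩ := card_eq_one.1 ((card_erase_of_mem hiS).trans (by omega : #S - 1 = 1))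
    have hji : j ∈ S.erase i := hj ▸ mem_singleton_self j
    have hS : {i, j} = S := by rw [← insert_erase hiS, hj]
    exact ⟨j, ⟨(mem_erase.1 hji).1, hS ▸ hne⟩, by rw [hS]⟩
  · rintro ⟨j, ⟨hji, hne⟩, rfl⟩
    exact ⟨hP.isEdge_face_pair hji.symm hne, fun x hx => mem_facet.2 ⟨hx.1, hx.2 (by simp)⟩⟩

theorem IsSimple.numEdges_eq_card_verticesOf (hP : P.IsSimple) (i : Fin P.m) :
    P.numEdges i = #(P.verticesOf {i}) := by
  have hinj : Set.InjOn (fun j => P.face {i, j}) (P.neighbors i) := fun j hj k hk h => by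
    rw [mem_coe, mem_neighbors] at hj hk
    have hsub : ({i, j} : Finset (Fin P.m)) ⊆ {i, k} := hP.subset_of_face_subset hk.2 h.ge
    have hjk : j ∈ ({i, k} : Finset (Fin P.m)) := hsub (by simp)
    simpa [hj.1] using hjk
  rw [numEdges, hP.setOf_isEdge_subset_facet, hinj.ncard_image, Set.ncard_coe_finset,
    hP.card_neighbors]

/-- The vertices at which the facets `c j` succeed each other form a connected component of the
graph of the facet `i`. -/
theorem IsSimple.numEdges_eq_card_of_cycle (hP : P.IsSimple) {ι : Type*} [Fintype ι] [Nonempty ι]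
    {σ : Equiv.Perm ι} (hσ : ∀ j, σ (σ j) ≠ j) {c : ι → Fin P.m} (hc : Function.Injective c)
    (hci : ∀ j, i ≠ c j) (h : ∀ j, ∃ v ∈ P.verticesOf {i, c j}, c (σ j) ∈ P.active v) :
    P.numEdges i = Fintype.card ι := by
  classical
  choose v hv hv' using h
  have hσ' : ∀ j, j ≠ σ j := fun j h => hσ j (by rw [← h, ← h])
  have hact : ∀ j, P.active (v j) = {i, c j, c (σ j)} := fun j =>
    hP.active_eq_triple (hv j) (hv' j) (hci j) (hci _) (hc.ne (hσ' j))
  have hinj : Function.Injective v := fun j k hjk =>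
    injective_insert_pair_perm hσ hc hci (by simp only [← hact, hjk])
  have hedge : ∀ j, P.verticesOf {i, c (σ j)} = {v j, v (σ j)} := fun j =>
    hP.verticesOf_eq_pair (by rw [card_pair (hci _)])
      (mem_verticesOf_pair.2 ⟨(mem_verticesOf.1 (hv j)).1, by simp [hact], hv' j⟩) (hv _)
      (hinj.ne (hσ' j))
  rw [hP.numEdges_eq_card_verticesOf, hP.verticesOf_eq_of_closed (V := univ.image v) ?_ ?_ ?_,
    card_image_of_injective _ hinj, card_univ]
  · intro w hw
    obtain ⟨j, -, rfl⟩ := mem_image.1 hw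
    exact mem_verticesOf_singleton.2 ⟨(mem_verticesOf.1 (hv j)).1, by simp [hact]⟩
  · exact univ_nonempty.image v
  · intro w hw k hk
    obtain ⟨j, -, rfl⟩ := mem_image.1 hw
    simp only [hact, Finset.mem_sdiff, mem_insert, mem_singleton] at hk ⊢
    rcases hk with ⟨rfl | rfl | rfl, hki⟩
    · exact absurd rfl hki
    · rw [show ({i, c j, c (σ j)} : Finset _).erase (c j) = {i, c (σ j)} by
        grind [hc.ne (hσ' j)], hedge]
      simp [insert_subset_iff]
    · obtain ⟨k, rfl⟩ := σ.surjective j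
      rw [show ({i, c (σ k), c (σ (σ k))} : Finset _).erase (c (σ (σ k))) = {i, c (σ k)} by
        grind [hc.ne (hσ' (σ k))], hedge]
      simp [insert_subset_iff]

end Polygons

section Section

variable {n : ℕ} {P : ConvexPolytope n} {b t : ℝ} {u v x y : EuclideanSpace ℝ (Fin n)}
  {l : Fin P.m} {S : Finset (Fin P.m)}

lemma slack_sum_smul {ι : Type*} (s : Finset ι) (r : ι → ℝ) (q : ι → EuclideanSpace ℝ (Fin n))
    (l : Fin P.m) :
    P.slack l (∑ j ∈ s, r j • q j) =
      ∑ j ∈ s, r j * P.slack l (q j) + (1 - ∑ j ∈ s, r j) * P.b l := by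
  simp only [slack, inner_sum, inner_smul_right, mul_add, sum_add_distrib, ← sum_mul]
  ring

lemma slack_pos_of_mem_convexHull {K : Set (EuclideanSpace ℝ (Fin n))}
    (h : ∀ y ∈ K, 0 < P.slack l y) (hx : x ∈ convexHull ℝ K) : 0 < P.slack l x := by
  simp only [slack, ← neg_lt_iff_pos_add] at h ⊢
  exact lt_inner_of_mem_convexHull h hx

lemma active_lineMap (hx : x ∈ P.carrier) (hy : y ∈ P.carrier) (ht : t ∈ Set.Ioo 0 1) :
    P.active (AffineMap.lineMap x y t) = P.active x ∩ P.active y := by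
  ext l
  have hslack : P.slack l (AffineMap.lineMap x y t) = (1 - t) * P.slack l x + t * P.slack l y := by
    simp only [AffineMap.lineMap_apply_module, slack, inner_add_right, inner_smul_right]
    ring
  have hx := mul_nonneg (sub_nonneg.2 ht.2.le) (mem_carrier.1 hx l)
  have hy := mul_nonneg ht.1.le (mem_carrier.1 hy l)
  rw [mem_active, hslack, add_eq_zero_iff_of_nonneg hx hy, mem_inter, mem_active, mem_active,
    mul_eq_zero_iff_left (sub_pos.2 ht.2).ne', mul_eq_zero_iff_left ht.1.ne']

lemma IsSimple.exists_active_eq_lt_inner (hP : P.IsSimple) (hS : #S + 1 = n)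
    (hv : v ∈ P.verticesOf S) (hb : b < inner ℝ u v) :
    ∃ q ∈ P.carrier, P.active q = S ∧ b < inner ℝ u q := by
  obtain ⟨w, hw, hwv⟩ := exists_mem_ne
    ((hP.card_verticesOf_eq_two hS ⟨v, hv⟩).symm ▸ one_lt_two) v
  obtain ⟨hvtx, hSv⟩ := mem_verticesOf.1 hv
  obtain ⟨hwtx, hSw⟩ := mem_verticesOf.1 hw
  have hinter : P.active v ∩ P.active w = S := by
    have hne : P.active v ∩ P.active w ≠ P.active v := fun h =>
      hwv (hvtx.eq_of_active_subset (inter_eq_left.1 h))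
    have hlt := card_lt_card (inter_subset_left.ssubset_of_ne hne)
    rw [hP.card_active hvtx] at hlt
    exact (eq_of_subset_of_card_le (subset_inter hSv hSw) (by omega)).symm
  have hcont : Tendsto (fun t : ℝ => inner ℝ u (AffineMap.lineMap v w t)) (𝓝[>] 0)
      (𝓝 (inner ℝ u (AffineMap.lineMap v w (0 : ℝ)))) :=
    (Continuous.tendsto (by fun_prop) 0).mono_left nhdsWithin_le_nhds
  obtain ⟨t, ht, hbt⟩ := (Eventually.and (Ioo_mem_nhdsGT one_pos)
    (hcont.eventually_const_lt (by simpa using hb))).exists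
  exact ⟨AffineMap.lineMap v w t,
    convex_carrier.lineMap_mem hvtx.mem_carrier hwtx.mem_carrier ⟨ht.1.le, ht.2.le⟩,
    (active_lineMap hvtx.mem_carrier hwtx.mem_carrier ht).trans hinter, hbt⟩

lemma affineIndependent_of_mem_active_iff {ι : Type*} {q : ι → EuclideanSpace ℝ (Fin n)}
    {d : ι → Fin P.m} (hd : ∀ i j, d i ∈ P.active (q j) ↔ i ≠ j) : AffineIndependent ℝ q := by
  simp only [mem_active] at hd
  refine affineIndependent_iff.2 fun s r hr hrq i hi => ?_
  have hslack := slack_sum_smul s r q (d i)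
  rw [hrq, hr, sum_eq_single_of_mem i hi fun j _ hji => by rw [(hd i j).2 hji.symm, mul_zero]]
    at hslack
  have hmul : r i * P.slack (d i) (q i) = 0 := by simpa [slack] using hslack
  exact (mul_eq_zero.1 hmul).resolve_right fun h => (hd i i).1 h rfl

/-- The facets `d i` make the slacks `P.slack (d i)` barycentric coordinates, up to scaling. -/
lemma exists_inner_eq_and_mem_convexHull (hn : n ≠ 0) {q : Fin n → EuclideanSpace ℝ (Fin n)}
    (hq : ∀ j, q j ∈ P.carrier) {d : Fin n → Fin P.m} (hd : ∀ i j, d i ∈ P.active (q j) ↔ i ≠ j) :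
    ∃ u b, (∀ j, inner ℝ u (q j) = b) ∧
      ∀ x ∈ P.carrier, inner ℝ u x = b → x ∈ convexHull ℝ (Set.range q) := by
  have hzero : ∀ i j, j ≠ i → P.slack (d i) (q j) = 0 := fun i j hji =>
    mem_active.1 ((hd i j).2 hji.symm)
  have hpos : ∀ i, 0 < P.slack (d i) (q i) := fun i =>
    slack_pos_of_notMem_active (hq i) fun h => (hd i i).1 h rfl
  have hsum : ∀ (r : Fin n → ℝ) i, ∑ j, r j * P.slack (d i) (q j) = r i * P.slack (d i) (q i) :=
    fun r i => sum_eq_single_of_mem i (mem_univ i) fun j _ hji => by rw [hzero i j hji, mul_zero]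
  have hind := affineIndependent_of_mem_active_iff hd
  have : Nonempty (Fin n) := ⟨⟨0, by omega⟩⟩
  have hdim : Module.finrank ℝ (affineSpan ℝ (Set.range q)).direction + 1 =
      Module.finrank ℝ (EuclideanSpace ℝ (Fin n)) := by
    have hcard : Fintype.card (Fin n) = n - 1 + 1 := by
      rw [Fintype.card_fin]
      omega
    rw [direction_affineSpan, hind.finrank_vectorSpan hcard, finrank_euclideanSpace_fin]
    omega
  obtain ⟨u, b, hub⟩ := exists_inner_eq_iff_mem_affineSubspace
    ((affineSpan_nonempty ℝ).2 (Set.range_nonempty q)) hdim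
  refine ⟨u, b, fun j => (hub _).2 (subset_affineSpan ℝ _ ⟨j, rfl⟩), fun x hx hxb => ?_⟩
  obtain ⟨r, hr, rfl⟩ := eq_affineCombination_of_mem_affineSpan_of_fintype ((hub x).1 hxb)
  rw [univ.affineCombination_eq_linear_combination _ _ hr] at hx ⊢
  refine (convex_convexHull ℝ _).sum_mem (fun i _ => ?_) hr
    fun i _ => subset_convexHull ℝ _ ⟨i, rfl⟩
  have := mem_carrier.1 hx (d i)
  rw [slack_sum_smul, hr, hsum, sub_self, zero_mul, add_zero] at this
  exact nonneg_of_mul_nonneg_left this (hpos i)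

end Section

section Triads

variable {P : ConvexPolytope 3} {b : ℝ} {u v : EuclideanSpace ℝ (Fin 3)}
  {c : Fin 3 → Fin P.m} {j : Fin 3} {l : Fin P.m}

variable (P) in
/-- Three facets, indexed cyclically, that share edges pairwise but have no common vertex. -/
structure IsTriad (c : Fin 3 → Fin P.m) : Prop where
  adj : ∀ j, (P.verticesOf {c j, c (j + 1)}).Nonempty
  exists_notMem : ∀ v, P.IsVertex v → ∃ j, c j ∉ P.active v

lemma IsTriad.injective (h : P.IsTriad c) : Function.Injective c := by
  refine injective_of_forall_ne_add_one fun j hj => ?_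
  obtain ⟨v, hv⟩ := h.adj (j + 1)
  rw [mem_verticesOf_pair] at hv
  obtain ⟨k, hk⟩ := h.exists_notMem v hv.1
  rcases fin_three_eq_or_eq_add j k with rfl | rfl | rfl
  exacts [hk (hj ▸ hv.2.1), hk hv.2.1, hk hv.2.2]

lemma IsTriad.mem_pair_iff (h : P.IsTriad c) (i j : Fin 3) :
    c (i + 2) ∈ ({c j, c (j + 1)} : Finset (Fin P.m)) ↔ i ≠ j := by
  simp only [mem_insert, mem_singleton, h.injective.eq_iff]
  clear h
  decide +revert

variable (P) in
/-- The plane `⟪u, ·⟫ = b` contains no vertices; it cuts the facets of the triad `c` and the edges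
between them, but no other facets. -/
structure Separates (u : EuclideanSpace ℝ (Fin 3)) (b : ℝ) (c : Fin 3 → Fin P.m) : Prop
    extends P.IsTriad c where
  inner_ne : ∀ v, P.IsVertex v → inner ℝ u v ≠ b
  sameSide : ∀ l ∉ Set.range c, ∀ v ∈ P.verticesOf {l}, ∀ w ∈ P.verticesOf {l},
    b < inner ℝ u v → b < inner ℝ u w
  upper : ∀ j, (P.upperVertices u b {c j, c (j + 1)}).Nonempty
  lower : ∀ j, (P.upperVertices (-u) (-b) {c j, c (j + 1)}).Nonempty

lemma Separates.neg (h : P.Separates u b c) : P.Separates (-u) (-b) c where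
  toIsTriad := h.toIsTriad
  inner_ne v hv := by simpa using h.inner_ne v hv
  sameSide l hl v hv w hw hlt := by
    simp only [inner_neg_left, neg_lt_neg_iff] at hlt ⊢
    refine lt_of_le_of_ne (not_lt.1 fun hgt => ?_) (h.inner_ne w (mem_verticesOf.1 hw).1)
    exact hlt.not_gt (h.sameSide l hl w hw v hv hgt)
  upper := h.lower
  lower := by simpa only [neg_neg] using h.upper

lemma upperVertices_nonempty_of_le (hb : ∀ v, P.IsVertex v → inner ℝ u v ≠ b)
    {q : EuclideanSpace ℝ (Fin 3)} (hq : q ∈ P.carrier) (hle : b ≤ inner ℝ u q) :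
    (P.upperVertices u b (P.active q)).Nonempty := by
  obtain ⟨v, hv, hsub, huv⟩ := exists_isVertex_inner_le u hq
  exact ⟨v, mem_upperVertices.2 ⟨mem_verticesOf.2 ⟨hv, hsub⟩,
    (hle.trans huv).lt_of_ne (hb v hv).symm⟩⟩

lemma IsSimple.separates_of_section (hP : P.IsSimple) (hc : P.IsTriad c)
    {q : Fin 3 → EuclideanSpace ℝ (Fin 3)} (hq : ∀ j, q j ∈ P.carrier)
    (hact : ∀ j, P.active (q j) = {c j, c (j + 1)}) (hqb : ∀ j, inner ℝ u (q j) = b)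
    (hsec : ∀ x ∈ P.carrier, inner ℝ u x = b → x ∈ convexHull ℝ (Set.range q)) :
    P.Separates u b c := by
  have hmiss : ∀ l ∉ Set.range c, ∀ x ∈ P.face {l}, inner ℝ u x ≠ b := by
    intro l hl x hx hxb
    refine (slack_pos_of_mem_convexHull ?_ (hsec x hx.1 hxb)).ne'
      (mem_active.1 (hx.2 (mem_singleton_self l)))
    rintro _ ⟨j, rfl⟩
    refine slack_pos_of_notMem_active (hq j) ?_
    rw [hact, mem_insert, mem_singleton]
    rintro (rfl | rfl) <;> exact hl (Set.mem_range_self _)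
  have hne : ∀ v, P.IsVertex v → inner ℝ u v ≠ b := by
    intro v hv hvb
    have hsub : P.active v ⊆ univ.image c := fun l hl => by
      by_contra hlc
      exact hmiss l (by simpa using hlc) v ⟨hv.mem_carrier, singleton_subset_iff.2 hl⟩ hvb
    have heq := eq_of_subset_of_card_le hsub (by
      rw [hP.card_active hv]
      exact card_image_le)
    obtain ⟨j, hj⟩ := hc.exists_notMem v hv
    exact hj (heq ▸ mem_image_of_mem c (mem_univ j))
  refine ⟨hc, hne, fun l hl v hv w hw => ?_, fun j => ?_, fun j => ?_⟩
  · exact lt_inner_of_convex_of_forall_inner_ne convex_face (hmiss l hl)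
      (mem_face_of_mem_verticesOf hv) (mem_face_of_mem_verticesOf hw)
  · exact hact j ▸ upperVertices_nonempty_of_le hne (hq j) (hqb j).ge
  · exact hact j ▸ upperVertices_nonempty_of_le (by simpa using hne) (hq j) (by simp [hqb])

theorem IsSimple.exists_separates_of_lt (hP : P.IsSimple) (hc : P.IsTriad c)
    (hup : ∀ j, (P.upperVertices u b {c j, c (j + 1)}).Nonempty) :
    ∃ u' b', P.Separates u' b' c ∧
      ∀ x ∈ P.carrier, inner ℝ u x < b → inner ℝ u' x < b' := by
  have hpoint : ∀ j, ∃ q ∈ P.carrier, P.active q = {c j, c (j + 1)} ∧ b < inner ℝ u q := by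
    intro j
    obtain ⟨v, hv⟩ := hup j
    rw [mem_upperVertices] at hv
    refine hP.exists_active_eq_lt_inner ?_ hv.1 hv.2
    rw [card_pair (hc.injective.ne (fin_three_ne_add_one j))]
  choose q hq hact hqb using hpoint
  obtain ⟨u', b', hqb', hsec⟩ := exists_inner_eq_and_mem_convexHull three_ne_zero hq
    (d := fun i => c (i + 2)) fun i j => by rw [hact, hc.mem_pair_iff]
  have hsep := hP.separates_of_section hc hq hact hqb' hsec
  have hconv : Convex ℝ {x | x ∈ P.carrier ∧ inner ℝ u x < b} :=
    convex_carrier.inter (convex_halfSpace_lt (innerₛₗ ℝ u).isLinear b)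
  have hne : ∀ x ∈ {x | x ∈ P.carrier ∧ inner ℝ u x < b}, inner ℝ u' x ≠ b' := by
    rintro x ⟨hx, hxb⟩ hxb'
    refine hxb.not_gt (lt_inner_of_mem_convexHull ?_ (hsec x hx hxb'))
    rintro _ ⟨j, rfl⟩
    exact hqb j
  by_cases hside : ∃ y ∈ P.carrier, inner ℝ u y < b ∧ b' < inner ℝ u' y
  · obtain ⟨y, hy, hyb, hyb'⟩ := hside
    refine ⟨-u', -b', hsep.neg, fun x hx hxb => ?_⟩
    rw [inner_neg_left, neg_lt_neg_iff]
    exact lt_inner_of_convex_of_forall_inner_ne hconv hne ⟨hy, hyb⟩ ⟨hx, hxb⟩ hyb'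
  · push Not at hside
    exact ⟨u', b', hsep, fun x hx hxb => (hside x hx hxb).lt_of_ne (hne x ⟨hx, hxb⟩)⟩

lemma Separates.mem_above_of_mem_upperVertices (h : P.Separates u b c) (hl : l ∉ Set.range c)
    (hv : v ∈ P.upperVertices u b {l}) : l ∈ P.above u b := by
  rw [mem_upperVertices] at hv
  exact mem_above.2 ⟨⟨v, hv.1⟩, fun w hw => h.sameSide l hl v hv.1 w hw hv.2⟩

lemma Separates.notMem_above (h : P.Separates u b c) (j : Fin 3) : c j ∉ P.above u b := by
  intro hj
  obtain ⟨v, hv⟩ := h.lower j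
  simp only [mem_upperVertices, mem_verticesOf_pair, inner_neg_left, neg_lt_neg_iff] at hv
  exact hv.2.not_gt ((mem_above.1 hj).2 v (mem_verticesOf_singleton.2 ⟨hv.1.1, hv.1.2.1⟩))

lemma Separates.disjoint_above (h : P.Separates u b c) :
    Disjoint (P.above u b) (univ.image c) :=
  disjoint_right.2 fun l hl => by
    obtain ⟨j, -, rfl⟩ := mem_image.1 hl
    exact h.notMem_above j

lemma Separates.upperVertices_nonempty_iff (h : P.Separates u b c) :
    (P.upperVertices u b {l}).Nonempty ↔ l ∈ P.above u b ∪ univ.image c := by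
  simp only [mem_union, mem_image, mem_univ, true_and]
  refine ⟨fun ⟨v, hv⟩ => or_iff_not_imp_right.2 fun hl =>
    h.mem_above_of_mem_upperVertices hl hv, ?_⟩
  rintro (hl | ⟨j, rfl⟩)
  · obtain ⟨⟨v, hv⟩, hlt⟩ := mem_above.1 hl
    exact ⟨v, mem_upperVertices.2 ⟨hv, hlt v hv⟩⟩
  · obtain ⟨v, hv⟩ := h.upper j
    rw [mem_upperVertices, mem_verticesOf_pair] at hv
    exact ⟨v, mem_upperVertices.2 ⟨mem_verticesOf_singleton.2 ⟨hv.1.1, hv.1.2.1⟩, hv.2⟩⟩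

lemma Separates.card_upperVertices_empty (hP : P.IsSimple) (h : P.Separates u b c) :
    #(P.upperVertices u b ∅) = 2 * #(P.above u b) + 1 := by
  obtain ⟨v, hv⟩ := h.upper 0
  obtain ⟨w, hw⟩ := h.lower 0
  simp only [mem_upperVertices, mem_verticesOf, inner_neg_left, neg_lt_neg_iff] at hv hw
  have hfilter : ({l | (P.upperVertices u b {l}).Nonempty} : Finset (Fin P.m)) =
      P.above u b ∪ univ.image c := by
    ext l
    rw [mem_filter, and_iff_right (mem_univ l), h.upperVertices_nonempty_iff]
  have heuler := hP.card_upperVertices_add_two h.inner_ne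
    ⟨v, mem_upperVertices.2 ⟨mem_verticesOf.2 ⟨hv.1.1, empty_subset _⟩, hv.2⟩⟩ ⟨w, hw.1.1, hw.2⟩
  rw [hfilter, card_union_of_disjoint h.disjoint_above, card_image_of_injective _ h.injective,
    card_univ, Fintype.card_fin] at heuler
  omega

theorem Separates.sum_numEdges_above (hP : P.IsSimple) (h : P.Separates u b c) :
    ∑ l ∈ P.above u b, P.numEdges l + ∑ j, #(P.upperVertices u b {c j}) =
      6 * #(P.above u b) + 3 := by
  have hcount := hP.sum_card_upperVertices u b
  rw [← sum_subset (subset_univ (P.above u b ∪ univ.image c)), sum_union h.disjoint_above,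
    sum_image h.injective.injOn, h.card_upperVertices_empty hP] at hcount
  · have habove : ∀ l ∈ P.above u b, #(P.upperVertices u b {l}) = P.numEdges l := fun l hl => by
      rw [hP.numEdges_eq_card_verticesOf, upperVertices, filter_true_of_mem (mem_above.1 hl).2]
    rw [sum_congr rfl habove] at hcount
    exact hcount.trans (by ring)
  · intro l _ hl
    rwa [← h.upperVertices_nonempty_iff, not_nonempty_iff_eq_empty, ← card_eq_zero] at hl

end Triads

section Descent

variable {P : ConvexPolytope 3} {b : ℝ} {u w : EuclideanSpace ℝ (Fin 3)}
  {v : Fin 3 → EuclideanSpace ℝ (Fin 3)} {c d : Fin 3 → Fin P.m} {j : Fin 3} {l : Fin P.m}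

lemma Separates.exists_above_ssubset (hP : P.IsSimple) (h : P.Separates u b c)
    (hd : ∀ v, P.IsVertex v → ∃ j, d j ∉ P.active v)
    (hup : ∀ j, (P.upperVertices u b {d j, d (j + 1)}).Nonempty) (hj : d j ∈ P.above u b) :
    ∃ u' b', P.Separates u' b' d ∧ P.above u' b' ⊂ P.above u b := by
  obtain ⟨u', b', hsep, hlt⟩ := hP.exists_separates_of_lt
    ⟨fun j => (hup j).mono (filter_subset _ _), hd⟩ hup
  refine ⟨u', b', hsep, (Finset.ssubset_iff_of_subset fun l hl => ?_).2
    ⟨d j, hj, hsep.notMem_above j⟩⟩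
  rw [mem_above] at hl ⊢
  refine ⟨hl.1, fun v hv => not_le.1 fun hle => (hl.2 v hv).not_gt ?_⟩
  have hv' := (mem_verticesOf.1 hv).1
  exact hlt v hv'.mem_carrier (hle.lt_of_ne (h.inner_ne v hv'))

variable (P) in
/-- A plane separating the triad `c`, together with the vertex `v j` above it on the edge between
`c j` and `c (j + 1)` and the third facet `d j` through this vertex. -/
structure HasCorners (u : EuclideanSpace ℝ (Fin 3)) (b : ℝ) (c : Fin 3 → Fin P.m)
    (v : Fin 3 → EuclideanSpace ℝ (Fin 3)) (d : Fin 3 → Fin P.m) : Prop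
    extends P.Separates u b c where
  mem_upperVertices_pair : ∀ j, v j ∈ P.upperVertices u b {c j, c (j + 1)}
  notMem_range : ∀ j, d j ∉ Set.range c
  active_eq : ∀ j, P.active (v j) = {c j, c (j + 1), d j}

lemma Separates.exists_hasCorners (hP : P.IsSimple) (h : P.Separates u b c) :
    ∃ v d, P.HasCorners u b c v d := by
  have hthird : ∀ j, ∃ v d, v ∈ P.upperVertices u b {c j, c (j + 1)} ∧ d ∉ Set.range c ∧
      P.active v = {c j, c (j + 1), d} := by
    intro j
    obtain ⟨v, hv⟩ := h.upper j
    have hv' := (mem_upperVertices.1 hv).1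
    obtain ⟨d, hd, hd', hact⟩ := hP.exists_active_eq_triple
      (h.injective.ne (fin_three_ne_add_one j)) hv'
    refine ⟨v, d, hv, ?_, hact⟩
    rintro ⟨k, rfl⟩
    obtain ⟨i, hi⟩ := h.exists_notMem v (mem_verticesOf.1 hv').1
    simp only [hact, mem_insert, mem_singleton, h.injective.eq_iff] at hi
    rw [h.injective.ne_iff] at hd hd'
    exact hi ((by decide : ∀ i j k : Fin 3, k ≠ j → k ≠ j + 1 → i = j ∨ i = j + 1 ∨ i = k)
      i j k hd hd')
  choose v d hv hd hact using hthird
  exact ⟨v, d, h, hv, hd, hact⟩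

namespace HasCorners

variable (h : P.HasCorners u b c v d)
include h

lemma isVertex (j : Fin 3) : P.IsVertex (v j) :=
  (mem_verticesOf.1 (mem_upperVertices.1 (h.mem_upperVertices_pair j)).1).1

lemma lt_inner (j : Fin 3) : b < inner ℝ u (v j) :=
  (mem_upperVertices.1 (h.mem_upperVertices_pair j)).2

lemma mem_active_iff (j k : Fin 3) : c k ∈ P.active (v j) ↔ k = j ∨ k = j + 1 := by
  have hne : c k ≠ d j := fun hk => h.notMem_range j ⟨k, hk⟩
  simp only [h.active_eq, mem_insert, mem_singleton, h.injective.eq_iff, hne, or_false]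

lemma injective : Function.Injective v := fun j k hjk => by
  have hiff : ∀ i, (i = j ∨ i = j + 1) ↔ (i = k ∨ i = k + 1) := fun i => by
    rw [← h.mem_active_iff, hjk, h.mem_active_iff]
  clear h hjk
  decide +revert

lemma mem_upperVertices_singleton_of_mem (hl : l ∈ P.active (v j)) :
    v j ∈ P.upperVertices u b {l} :=
  mem_upperVertices.2 ⟨mem_verticesOf_singleton.2 ⟨h.isVertex j, hl⟩, h.lt_inner j⟩

lemma pair_subset_upperVertices (j : Fin 3) :
    {v j, v (j + 1)} ⊆ P.upperVertices u b {c (j + 1)} :=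
  insert_subset_iff.2 ⟨h.mem_upperVertices_singleton_of_mem (by simp [h.active_eq]),
    singleton_subset_iff.2 (h.mem_upperVertices_singleton_of_mem (by simp [h.active_eq]))⟩

lemma card_pair (j : Fin 3) : #{v j, v (j + 1)} = 2 :=
  Finset.card_pair (h.injective.ne (fin_three_ne_add_one j))

lemma two_le_card_upperVertices (j : Fin 3) : 2 ≤ #(P.upperVertices u b {c (j + 1)}) :=
  (h.card_pair j).ge.trans (card_le_card (h.pair_subset_upperVertices j))

lemma mem_above (j : Fin 3) : d j ∈ P.above u b :=
  h.mem_above_of_mem_upperVertices (h.notMem_range j)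
    (h.mem_upperVertices_singleton_of_mem (j := j) (by simp [h.active_eq]))

lemma eq_of_mem_upperVertices_pair (hP : P.IsSimple)
    (hw : w ∈ P.upperVertices u b {c j, c (j + 1)}) : w = v j := by
  obtain ⟨z, hz⟩ := h.lower j
  have hv := h.mem_upperVertices_pair j
  simp only [mem_upperVertices, inner_neg_left, neg_lt_neg_iff] at hz hv hw
  have hcard : #{c j, c (j + 1)} + 1 = 3 := by
    rw [Finset.card_pair (h.toIsTriad.injective.ne (fin_three_ne_add_one j))]
  have heq := hP.verticesOf_eq_pair hcard hv.1 hz.1 (by rintro rfl; exact hv.2.not_gt hz.2)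
  have hwz : w = v j ∨ w = z := by simpa [heq] using hw.1
  refine hwz.resolve_right ?_
  rintro rfl
  exact hw.2.not_gt hz.2

lemma exists_ne_mem_upperVertices (hP : P.IsSimple) (hw : w ∈ P.upperVertices u b {c j})
    (hl : l ∈ P.active w) (hlc : l ∉ Set.range c) :
    ∃ z ∈ P.upperVertices u b {c j}, z ≠ w ∧ l ∈ P.active z := by
  rw [mem_upperVertices, mem_verticesOf_singleton] at hw
  have hlw : w ∈ P.upperVertices u b {l} :=
    mem_upperVertices.2 ⟨mem_verticesOf_singleton.2 ⟨hw.1.1, hl⟩, hw.2⟩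
  have hall := (ConvexPolytope.mem_above.1 (h.mem_above_of_mem_upperVertices hlc hlw)).2
  have hcard := hP.card_verticesOf_pair (fun hcl : c j = l => hlc ⟨j, hcl⟩)
    ⟨w, mem_verticesOf_pair.2 ⟨hw.1.1, hw.1.2, hl⟩⟩
  obtain ⟨z, hz, hzw⟩ := exists_mem_ne (hcard ▸ one_lt_two) w
  rw [mem_verticesOf_pair] at hz
  exact ⟨z, mem_upperVertices.2 ⟨mem_verticesOf_singleton.2 ⟨hz.1, hz.2.1⟩,
    hall z (mem_verticesOf_singleton.2 ⟨hz.1, hz.2.2⟩)⟩, hzw, hz.2.2⟩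

lemma eq_of_mem_active (hl : l ∈ P.active (v j)) (hlc : l ∉ Set.range c) : l = d j := by
  simp only [h.active_eq, mem_insert, mem_singleton] at hl
  rcases hl with rfl | rfl | rfl
  exacts [(hlc ⟨_, rfl⟩).elim, (hlc ⟨_, rfl⟩).elim, rfl]

lemma eq_of_card_eq_two (hP : P.IsSimple) (hcard : #(P.upperVertices u b {c (j + 1)}) = 2) :
    d j = d (j + 1) := by
  have heq := eq_of_subset_of_card_le (h.pair_subset_upperVertices j)
    (hcard.trans (h.card_pair j).symm).le
  obtain ⟨z, hz, hne, hdz⟩ := h.exists_ne_mem_upperVertices hP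
    (h.pair_subset_upperVertices j (mem_insert_self _ _)) (by simp [h.active_eq])
    (h.notMem_range j)
  rw [← heq, mem_insert, mem_singleton] at hz
  obtain rfl := hz.resolve_left hne
  exact h.eq_of_mem_active hdz (h.notMem_range j)

lemma notMem_range_of_mem_active (hP : P.IsSimple) (hw : w ∈ P.upperVertices u b {c (j + 1)})
    (hwj : w ≠ v j) (hwj' : w ≠ v (j + 1)) (hl : l ∈ P.active w) (hne : l ≠ c (j + 1)) :
    l ∉ Set.range c := by
  rw [mem_upperVertices, mem_verticesOf_singleton] at hw
  have hpair : ∀ k, w ≠ v k → ¬(c k ∈ P.active w ∧ c (k + 1) ∈ P.active w) := fun k hk hck =>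
    hk (h.eq_of_mem_upperVertices_pair hP
      (mem_upperVertices.2 ⟨mem_verticesOf_pair.2 ⟨hw.1.1, hck⟩, hw.2⟩))
  rintro ⟨k, rfl⟩
  rcases fin_three_eq_or_eq_add j k with rfl | rfl | rfl
  exacts [hpair _ hwj ⟨hl, hw.1.2⟩, hne rfl, hpair _ hwj' ⟨hw.1.2, hl⟩]

lemma exists_mem_upperVertices_of_card_eq_three (hP : P.IsSimple)
    (hcard : #(P.upperVertices u b {c (j + 1)}) = 3) :
    d j ≠ d (j + 1) ∧ ∃ w ∈ P.upperVertices u b {d j, d (j + 1)}, c (j + 1) ∈ P.active w := by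
  obtain ⟨w, hw, hwv⟩ := exists_mem_notMem_of_card_lt_card
    (by rw [hcard, h.card_pair]; norm_num : #{v j, v (j + 1)} < #(P.upperVertices u b {c (j + 1)}))
  have heq : insert w {v j, v (j + 1)} = P.upperVertices u b {c (j + 1)} :=
    eq_of_subset_of_card_le (insert_subset_iff.2 ⟨hw, h.pair_subset_upperVertices j⟩)
      (by rw [hcard, card_insert_of_notMem hwv, h.card_pair])
  rw [mem_insert, mem_singleton, not_or] at hwv
  have hsub : (P.active w).erase (c (j + 1)) ⊆ {d j, d (j + 1)} := by
    intro l hl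
    rw [mem_erase] at hl
    have hlc := h.notMem_range_of_mem_active hP hw hwv.1 hwv.2 hl.2 hl.1
    obtain ⟨z, hz, hzw, hlz⟩ := h.exists_ne_mem_upperVertices hP hw hl.2 hlc
    rw [← heq, mem_insert, mem_insert, mem_singleton] at hz
    rw [mem_insert, mem_singleton]
    rcases hz.resolve_left hzw with rfl | rfl
    exacts [.inl (h.eq_of_mem_active hlz hlc), .inr (h.eq_of_mem_active hlz hlc)]
  rw [mem_upperVertices, mem_verticesOf_singleton] at hw
  have hcardw : #((P.active w).erase (c (j + 1))) = 2 := by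
    rw [card_erase_of_mem hw.1.2, hP.card_active hw.1.1]
  have hne : d j ≠ d (j + 1) := fun hd => by
    have := card_le_card hsub
    rw [hcardw, ← hd, pair_eq_singleton, card_singleton] at this
    omega
  have herase := eq_of_subset_of_card_le hsub (hcardw.symm ▸ (Finset.card_pair hne).le)
  exact ⟨hne, w, mem_upperVertices.2 ⟨mem_verticesOf.2 ⟨hw.1.1,
    herase ▸ erase_subset _ _⟩, hw.2⟩, hw.1.2⟩

lemma numEdges_eq_three (hP : P.IsSimple) (hd : d j = d (j + 1))
    {p : EuclideanSpace ℝ (Fin 3)} (hp : P.IsVertex p) (hdp : d j ∈ P.active p)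
    (hcp : ∀ k, k ≠ j + 1 → c k ∈ P.active p) : P.numEdges (d j) = 3 := by
  refine hP.numEdges_eq_card_of_cycle (σ := finRotate 3) (by decide) h.toIsTriad.injective
    (fun k hk => h.notMem_range j ⟨k, hk.symm⟩) fun k => ?_
  simp only [finRotate_apply, mem_verticesOf_pair]
  rcases fin_three_eq_or_eq_add j k with rfl | rfl | rfl
  · exact ⟨v k, ⟨h.isVertex k, by simp [h.active_eq], by simp [h.active_eq]⟩,
      by simp [h.active_eq]⟩
  · exact ⟨v (j + 1), ⟨h.isVertex _, by simp [h.active_eq, hd], by simp [h.active_eq]⟩,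
      by simp [h.active_eq]⟩
  · exact ⟨p, ⟨hp, hdp, hcp _ ((by decide : ∀ j : Fin 3, j + 1 + 1 ≠ j + 1) j)⟩,
      hcp _ ((by decide : ∀ j : Fin 3, j + 1 + 1 + 1 ≠ j + 1) j)⟩

/-- The facet behind the only upper edge of `c (j + 1)` can replace `c (j + 1)` in the triad, since
it is not a triangle. -/
lemma exists_above_ssubset_of_card_eq_two (hP : P.IsSimple) (h3 : ∀ l, P.numEdges l ≠ 3)
    (hcard : #(P.upperVertices u b {c (j + 1)}) = 2) :
    ∃ u' b' c', P.Separates u' b' c' ∧ P.above u' b' ⊂ P.above u b := by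
  have hd := h.eq_of_card_eq_two hP hcard
  set c' := Function.update c (j + 1) (d j)
  have hself : c' (j + 1) = d j := Function.update_self ..
  have hother : ∀ k, k ≠ j + 1 → c' k = c k := fun k hk => Function.update_of_ne hk ..
  have hedge : ∀ k, c' k ∈ P.active (v k) ∧ c' (k + 1) ∈ P.active (v k) := by
    intro k
    have hne := (by decide : ∀ j : Fin 3, j ≠ j + 1 ∧ j + 1 + 1 ≠ j + 1 ∧ j + 1 + 1 + 1 ≠ j + 1) j
    rcases fin_three_eq_or_eq_add j k with rfl | rfl | rfl
    · simp only [hself, hother _ hne.1, h.active_eq, mem_insert, mem_singleton, true_or, or_true,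
        and_self]
    · simp only [hself, hother _ hne.2.1, hd, h.active_eq, mem_insert, mem_singleton, true_or,
        or_true, and_self]
    · simp only [hother _ hne.2.1, hother _ hne.2.2, h.active_eq, mem_insert, mem_singleton,
        true_or, or_true, and_self]
  have hmiss : ∀ p, P.IsVertex p → ∃ k, c' k ∉ P.active p := by
    intro p hp
    by_contra! hcp
    exact h3 (d j) (h.numEdges_eq_three hP hd hp (hself ▸ hcp (j + 1))
      fun k hk => hother k hk ▸ hcp k)
  obtain ⟨u', b', hsep⟩ := h.exists_above_ssubset hP hmiss
    (fun k => ⟨v k, mem_upperVertices.2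
      ⟨mem_verticesOf_pair.2 ⟨h.isVertex k, hedge k⟩, h.lt_inner k⟩⟩)
    (hself ▸ h.mem_above j)
  exact ⟨u', b', c', hsep⟩

lemma numEdges_eq_four (hP : P.IsSimple) (hd : Function.Injective d)
    {w : Fin 3 → EuclideanSpace ℝ (Fin 3)} (hw : ∀ j, w j ∈ P.verticesOf {d j, d (j + 1)})
    (hcw : ∀ j, c (j + 1) ∈ P.active (w j)) {p : EuclideanSpace ℝ (Fin 3)} (hp : P.IsVertex p)
    (hdp : ∀ j, d j ∈ P.active p) (j : Fin 3) : P.numEdges (d j) = 4 := by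
  have hdc : ∀ j k, d j ≠ c k := fun j k hjk => h.notMem_range j ⟨k, hjk.symm⟩
  have hw' := fun j => mem_verticesOf_pair.1 (hw j)
  have hj := (by decide : ∀ j : Fin 3, j + 1 + 1 + 1 = j) j
  have hne := (by decide : ∀ j : Fin 3, j ≠ j + 1 + 1) j
  have hwj := hw' (j + 1 + 1)
  have hcwj := hcw (j + 1 + 1)
  rw [hj] at hwj hcwj
  refine hP.numEdges_eq_card_of_cycle (σ := finRotate 4) (by decide)
    (c := ![c j, c (j + 1), d (j + 1), d (j + 1 + 1)]) ?_ ?_ ?_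
  · simp [Function.Injective, Fin.forall_fin_succ, hdc, (hdc _ _).symm, hd.eq_iff,
      h.toIsTriad.injective.eq_iff]
  · simp [Fin.forall_fin_succ, hdc, hd.eq_iff, hne]
  · simp only [Fin.forall_fin_succ, IsEmpty.forall_iff, and_true, mem_verticesOf_pair]
    exact ⟨⟨v j, ⟨h.isVertex j, by simp [h.active_eq], by simp [h.active_eq]⟩,
      by simp [h.active_eq]⟩, ⟨w j, ⟨(hw' j).1, (hw' j).2.1, hcw j⟩, (hw' j).2.2⟩,
      ⟨p, ⟨hp, hdp j, hdp (j + 1)⟩, hdp (j + 1 + 1)⟩,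
      ⟨w (j + 1 + 1), ⟨hwj.1, hwj.2.2, hwj.2.1⟩, hcwj⟩⟩

/-- Between `v j` and `v (j + 1)`, the facet `c (j + 1)` has one vertex, at which `d j` and
`d (j + 1)` meet. So the `d j` form a triad, unless they are quadrilaterals with a common vertex. -/
lemma exists_above_ssubset_of_forall_card_eq_three (hP : P.IsSimple)
    (h4 : ∀ v, P.IsVertex v → ∃ i ∈ P.active v, P.numEdges i ≠ 4)
    (hcard : ∀ j, #(P.upperVertices u b {c (j + 1)}) = 3) :
    ∃ u' b', P.Separates u' b' d ∧ P.above u' b' ⊂ P.above u b := by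
  choose hne w hw hcw using fun j => h.exists_mem_upperVertices_of_card_eq_three hP (hcard j)
  have hinj := injective_of_forall_ne_add_one hne
  refine h.exists_above_ssubset hP (fun p hp => ?_) (fun j => ⟨w j, hw j⟩) (h.mem_above 0)
  by_contra! hdp
  have hactp : univ.image d = P.active p := eq_of_subset_of_card_le
    (by simpa [subset_iff] using hdp)
    (by rw [card_image_of_injective _ hinj, hP.card_active hp, card_univ, Fintype.card_fin])
  obtain ⟨i, hi, hi4⟩ := h4 p hp
  obtain ⟨j, -, rfl⟩ := mem_image.1 (hactp ▸ hi)
  exact hi4 (h.numEdges_eq_four hP hinj (fun k => (mem_upperVertices.1 (hw k)).1) hcw hp hdp j)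

end HasCorners

lemma Separates.exists_above_ssubset_or_lt_sum (hP : P.IsSimple) (h3 : ∀ l, P.numEdges l ≠ 3)
    (h4 : ∀ v, P.IsVertex v → ∃ i ∈ P.active v, P.numEdges i ≠ 4) (h : P.Separates u b c) :
    (∃ u' b' c', P.Separates u' b' c' ∧ P.above u' b' ⊂ P.above u b) ∨
      9 < ∑ j, #(P.upperVertices u b {c j}) := by
  obtain ⟨v, d, hvd⟩ := h.exists_hasCorners hP
  by_cases htwo : ∃ j, #(P.upperVertices u b {c (j + 1)}) = 2
  · exact .inl (hvd.exists_above_ssubset_of_card_eq_two hP h3 htwo.choose_spec)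
  by_cases hthree : ∀ j, #(P.upperVertices u b {c (j + 1)}) = 3
  · obtain ⟨u', b', hsep⟩ := hvd.exists_above_ssubset_of_forall_card_eq_three hP h4 hthree
    exact .inl ⟨u', b', d, hsep⟩
  push Not at htwo hthree
  obtain ⟨j, hj⟩ := hthree
  have hle : ∀ j, 3 ≤ #(P.upperVertices u b {c (j + 1)}) := fun j =>
    (hvd.two_le_card_upperVertices j).lt_of_ne (htwo j).symm
  right
  calc 9 = ∑ _ : Fin 3, 3 := rfl
    _ < ∑ j, #(P.upperVertices u b {c (j + 1)}) :=
      sum_lt_sum (fun _ _ => hle _) ⟨j, mem_univ j, (hle j).lt_of_ne hj.symm⟩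
    _ = ∑ j, #(P.upperVertices u b {c j}) :=
      Equiv.sum_comp (Equiv.addRight (1 : Fin 3)) fun j => #(P.upperVertices u b {c j})

variable (P) in
/-- The total curvature `6 - k` of the `k`-gons with `k ≤ 6` above a plane; by truncated
subtraction, larger facets contribute `0`. -/
noncomputable def curvature (u : EuclideanSpace ℝ (Fin 3)) (b : ℝ) : ℕ :=
  ∑ l ∈ P.above u b, (6 - P.numEdges l)

lemma Separates.curvature_add_three (hP : P.IsSimple) (h : P.Separates u b c) :
    P.curvature u b + 3 =
      ∑ j, #(P.upperVertices u b {c j}) + ∑ l ∈ P.above u b, (P.numEdges l - 6) := by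
  have hsum := h.sum_numEdges_above hP
  have hcurv : P.curvature u b + ∑ l ∈ P.above u b, P.numEdges l =
      6 * #(P.above u b) + ∑ l ∈ P.above u b, (P.numEdges l - 6) := by
    rw [curvature, ← sum_add_distrib, mul_comm, ← smul_eq_mul, ← sum_const, ← sum_add_distrib]
    exact sum_congr rfl fun l _ => by omega
  omega

theorem Separates.six_lt_curvature (hP : P.IsSimple) (h3 : ∀ l, P.numEdges l ≠ 3)
    (h4 : ∀ v, P.IsVertex v → ∃ i ∈ P.active v, P.numEdges i ≠ 4) (h : P.Separates u b c) :
    6 < P.curvature u b := by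
  induction hs : P.above u b using Finset.strongInduction generalizing u b c with
  | H s ih =>
    subst hs
    rcases h.exists_above_ssubset_or_lt_sum hP h3 h4 with ⟨u', b', d, hsep, hss⟩ | hlt
    · exact (ih _ hss hsep rfl).trans_le (sum_le_sum_of_subset hss.1)
    · have := h.curvature_add_three hP
      omega

lemma card_upperVertices_add_card_upperVertices_neg (hb : ∀ v, P.IsVertex v → inner ℝ u v ≠ b)
    (S : Finset (Fin P.m)) :
    #(P.upperVertices u b S) + #(P.upperVertices (-u) (-b) S) = #(P.verticesOf S) := by
  rw [← card_filter_add_card_filter_not (s := P.verticesOf S) fun v => b < inner ℝ u v,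
    upperVertices, upperVertices]
  congr 2
  refine filter_congr fun v hv => ?_
  rw [inner_neg_left, neg_lt_neg_iff, not_lt]
  exact ⟨le_of_lt, fun h => h.lt_of_ne (hb v (mem_verticesOf.1 hv).1)⟩

lemma disjoint_above_neg (u : EuclideanSpace ℝ (Fin 3)) (b : ℝ) :
    Disjoint (P.above u b) (P.above (-u) (-b)) := by
  refine disjoint_left.2 fun l hl hl' => ?_
  obtain ⟨⟨v, hv⟩, hall⟩ := mem_above.1 hl
  have hlt := (mem_above.1 hl').2 v hv
  rw [inner_neg_left, neg_lt_neg_iff] at hlt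
  exact hlt.not_gt (hall v hv)

/-- Each side of a separating plane has curvature at least `7`, but together the two sides have
curvature at most `13`. -/
theorem IsSimple.not_isTriad (hP : P.IsSimple) (h3 : ∀ l, P.numEdges l ≠ 3)
    (h4 : ∀ v, P.IsVertex v → ∃ i ∈ P.active v, P.numEdges i ≠ 4)
    (h6 : ∑ l, (P.numEdges l - 6) ≤ 1) : ¬P.IsTriad c := by
  intro hc
  obtain ⟨u, b, h, -⟩ := hP.exists_separates_of_lt (u := 0) (b := -1) hc fun j =>
    (hc.adj j).imp fun v hv => mem_upperVertices.2 ⟨hv, by simp⟩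
  have hsides : ∑ j, #(P.upperVertices u b {c j}) + ∑ j, #(P.upperVertices (-u) (-b) {c j}) =
      ∑ j, P.numEdges (c j) := by
    simp only [← sum_add_distrib, hP.numEdges_eq_card_verticesOf,
      card_upperVertices_add_card_upperVertices_neg h.inner_ne]
  have hmiddle : ∑ j, P.numEdges (c j) ≤ 18 + ∑ l ∈ univ.image c, (P.numEdges l - 6) := by
    rw [sum_image h.injective.injOn]
    calc ∑ j, P.numEdges (c j) ≤ ∑ j, (6 + (P.numEdges (c j) - 6)) :=
          sum_le_sum fun j _ => by omega
      _ = 18 + ∑ j, (P.numEdges (c j) - 6) := by simp [sum_add_distrib]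
  have htotal := sum_le_sum_of_subset (f := fun l => P.numEdges l - 6)
    (subset_univ (P.above u b ∪ P.above (-u) (-b) ∪ univ.image c))
  rw [sum_union (disjoint_union_left.2 ⟨h.disjoint_above, h.neg.disjoint_above⟩),
    sum_union (disjoint_above_neg u b)] at htotal
  have hupper := h.six_lt_curvature hP h3 h4
  have hlower := h.neg.six_lt_curvature hP h3 h4
  have hupper' := h.curvature_add_three hP
  have hlower' := h.neg.curvature_add_three hP
  omega

end Descent

section Flag

variable {P : ConvexPolytope 3} {c : Fin 3 → Fin P.m} {k : ℕ}

lemma p_eq_card_filter (k : ℕ) : P.p k = #{l | P.numEdges l = k} := by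
  rw [p, ← Set.ncard_coe_finset, coe_filter_univ]

lemma numEdges_ne_of_p_eq_zero (h : P.p k = 0) (l : Fin P.m) : P.numEdges l ≠ k := by
  rw [p_eq_card_filter, card_eq_zero, filter_eq_empty_iff] at h
  exact h (mem_univ l)

lemma sum_numEdges_sub_six_eq_p_seven (h8 : ∀ k, 8 ≤ k → P.p k = 0) :
    ∑ l, (P.numEdges l - 6) = P.p 7 := by
  rw [p_eq_card_filter, card_filter]
  refine sum_congr rfl fun l _ => ?_
  have : P.numEdges l < 8 := not_le.1 fun h => numEdges_ne_of_p_eq_zero (h8 _ h) l rfl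
  split_ifs <;> omega

lemma IsSimple.exists_numEdges_ne (hP : P.IsSimple) (h : P.p k ≤ 2)
    {v : EuclideanSpace ℝ (Fin 3)} (hv : P.IsVertex v) :
    ∃ i, v ∈ P.facet i ∧ P.numEdges i ≠ k := by
  rw [p_eq_card_filter] at h
  obtain ⟨i, hi, hik⟩ := exists_mem_notMem_of_card_lt_card
    (h.trans_lt (by rw [hP.card_active hv]; norm_num : 2 < #(P.active v)))
  exact ⟨i, mem_facet.2 ⟨hv.mem_carrier, hi⟩, by simpa using hik⟩

lemma exists_isVertex_of_not_isTriad (hc : ¬P.IsTriad c)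
    (hadj : ∀ j, (P.facet (c j) ∩ P.facet (c (j + 1))).Nonempty) :
    ∃ v, P.IsVertex v ∧ ∀ j, c j ∈ P.active v := by
  by_contra! hno
  refine hc ⟨fun j => ?_, hno⟩
  rw [verticesOf_nonempty_iff, ← facet_inter_facet]
  exact hadj j

lemma IsBelt.isTriad (h : P.IsBelt c) : P.IsTriad c := by
  obtain ⟨-, hempty, hadj⟩ := h
  by_contra hc
  obtain ⟨v, hv, hcv⟩ := exists_isVertex_of_not_isTriad hc fun j =>
    (hadj j (j + 1) (fin_three_ne_add_one j)).2 (.inl (finRotate_apply j).symm)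
  exact Set.notMem_empty v
    (hempty ▸ Set.mem_iInter.2 fun j => mem_facet.2 ⟨hv.mem_carrier, hcv j⟩)

theorem IsSimple.isFlag (hP : P.IsSimple) (h3 : ∀ l, P.numEdges l ≠ 3)
    (h : ∀ c, ¬P.IsTriad c) : P.IsFlag := by
  classical
  refine ⟨hP, fun S hS hpair => ?_⟩
  have : Nonempty S := hS.to_subtype
  have hvertex : ∀ c : Fin 3 → S, ∃ v, P.IsVertex v ∧ ∀ j, (c j : Fin P.m) ∈ P.active v := fun c =>
    exists_isVertex_of_not_isTriad (h _) fun j => hpair _ (c j).2 _ (c (j + 1)).2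
  rcases Nat.lt_or_ge 3 (Fintype.card S) with hlt | hle
  · obtain ⟨e⟩ := Function.Embedding.nonempty_of_card_le ((Fintype.card_fin 4).trans_le hlt)
    have he : Function.Injective fun j => (e j : Fin P.m) :=
      Subtype.val_injective.comp e.injective
    refine absurd (hP.numEdges_eq_card_of_cycle (i := e 0) (c := fun j : Fin 3 => e j.succ)
      (σ := finRotate 3) (by decide) (he.comp (Fin.succ_injective 3))
      (fun j => he.ne (Fin.succ_ne_zero j).symm) fun j => ?_) (h3 _)
    obtain ⟨v, hv, hev⟩ := hvertex ![e 0, e j.succ, e (finRotate 3 j).succ]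
    exact ⟨v, mem_verticesOf_pair.2 ⟨hv, hev 0, hev 1⟩, hev 2⟩
  · obtain ⟨f⟩ := Function.Embedding.nonempty_of_card_le (hle.trans_eq (Fintype.card_fin 3).symm)
    obtain ⟨v, hv, hfv⟩ := hvertex (Function.invFun f)
    refine ⟨v, Set.mem_iInter₂.2 fun l hl => mem_facet.2 ⟨hv.mem_carrier, ?_⟩⟩
    obtain ⟨j, hj⟩ := Function.invFun_surjective f.injective ⟨l, hl⟩
    simpa only [hj] using hfv j

lemma IsFullerene.p_eq_zero (hP : P.IsFullerene) (h5 : k ≠ 5) (h6 : k ≠ 6) : P.p k = 0 := by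
  rw [p_eq_card_filter, card_eq_zero, filter_eq_empty_iff]
  rintro l - rfl
  exact (hP.2 l).elim h5 h6

end Flag

end ConvexPolytope

theorem mainTheorem3_general (P : ConvexPolytope 3) (hP : P.IsSimple) (h3 : P.p 3 = 0)
    (h4 : ∀ v, P.IsVertex v → ∃ i, v ∈ P.facet i ∧ P.numEdges i ≠ 4) (h7 : P.p 7 ≤ 1)
    (h8 : ∀ k : ℕ, 8 ≤ k → P.p k = 0) :
    (¬ ∃ c : Fin 3 → Fin P.m, P.IsBelt c) ∧ P.IsFlag := by
  have hne : ∀ l, P.numEdges l ≠ 3 := ConvexPolytope.numEdges_ne_of_p_eq_zero h3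
  have hvertex : ∀ v, P.IsVertex v → ∃ i ∈ P.active v, P.numEdges i ≠ 4 := fun v hv =>
    (h4 v hv).imp fun i hi => ⟨(ConvexPolytope.mem_facet.1 hi.1).2, hi.2⟩
  have htriad : ∀ c, ¬P.IsTriad c := fun c =>
    hP.not_isTriad hne hvertex ((ConvexPolytope.sum_numEdges_sub_six_eq_p_seven h8).trans_le h7)
  exact ⟨fun ⟨c, hc⟩ => htriad c hc.isTriad, hP.isFlag hne htriad⟩

theorem mainTheorem3 :
    (∀ P : ConvexPolytope 3, P.IsSimple → P.p 3 = 0 → P.p 4 ≤ 2 → P.p 7 ≤ 1 →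
      (∀ k : ℕ, 8 ≤ k → P.p k = 0) →
      (¬ ∃ c : Fin 3 → Fin P.m, P.IsBelt c) ∧ P.IsFlag) ∧
    (∀ P : ConvexPolytope 3, P.IsFullerene → P.IsFlag) := by
  have h := fun P hP h3 h4 => mainTheorem3_general P hP h3 fun _ => hP.exists_numEdges_ne h4
  exact ⟨h, fun P hP => (h P hP.1 (hP.p_eq_zero (by decide) (by decide))
    (by simp [hP.p_eq_zero]) (by simp [hP.p_eq_zero])
    fun k hk => hP.p_eq_zero (by omega) (by omega)).2⟩
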